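/- Let $a,b>-1$, $I=(0,1)$, and $\rho^{(a,b)}(x)=(1-x)^a x^b$. Let $L^2_{\rho^{(a,b)}}(I)$ be the space of real functions on $I$ (modulo a.e. equality) with $\|v\|_{\rho^{(a,b)}}^2:=\int_0^1\rho^{(a,b)}v^2\,dx<\infty$. *Coefficient spaces.* Let $G_j^{(a,b)}(x)=P_j^{(a,b)}(2x-1)$, where $P_j^{(a,b)}(t)=2^{-j}\sum_{m=0}^{j}\binom{j+a}{m}\binom{j+b}{j-m}(t-1)^{j-m}(t+1)^m$ are the Jacobi polynomials, let $\widetilde G_j^{(a,b)}=G_j^{(a,b)}/\|G_j^{(a,b)}\|_{\rho^{(a,b)}}$, and for $v\in L^2_{\rho^{(a,b)}}(I)$ put $v_j=\int_0^1\rho^{(a,b)}\,v\,\widetilde G_j^{(a,b)}\,dx$. For real $s\ge 0$ let $H^s_{(a,b)}(I)$ be the space of all $v\in L^2_{\rho^{(a,b)}}(I)$ with $\|v\|_{s,(a,b)}^2:=\sum_{j=0}^\infty(1+j^2)^s v_j^2<\infty$. *Weighted Sobolev spaces.* For an integer $n\ge 0$ let $H^n_{\rho^{(a,b)}}(I)$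 be the space of all $v\in L^2_{\rho^{(a,b)}}(I)$ whose weak derivatives $D^jv$, $0\le j\le n$, exist on $I$ and satisfy $\|v\|_{n,\rho^{(a,b)}}^2:=\sum_{j=0}^n\|D^jv\|_{\rho^{(a+j,b+j)}}^2<\infty$. For integers $0\le m<n$, a real number $s$ with $m<s<n$, and $\theta\in(0,1)$ with $s=(1-\theta)m+\theta n$, let $H^s_{\rho^{(a,b)}}(I)=[H^m_{\rho^{(a,b)}}(I),H^n_{\rho^{(a,b)}}(I)]_{\theta,2}$ be the space of all $u\in H^m_{\rho^{(a,b)}}(I)$ with $$\|u\|_{s,\rho^{(a,b)}}^2:=\int_0^\infty t^{-2\theta}K(t,u)^2\,\frac{dt}{t}<\infty,\qquad K(t,u)=\inf_{v\in H^n_{\rho^{(a,b)}}(I)}\big(\|u-v\|_{m,\rho^{(a,b)}}+t\,\|v\|_{n,\rho^{(a,b)}}\big).$$ **Theorem.** For every $s\ge 0$ the spaces $H^s_{\rho^{(a,b)}}(I)$ and $H^s_{(a,b)}(I)$ coincide and their norms are equivalent. This holds for integer $s$ with $H^s_{\rho^{(a,b)}}(I)$ defined through derivatives, and for every real $s>0$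 and all integers $0\le m<s<n$ with $H^s_{\rho^{(a,b)}}(I)$ defined by interpolation between $m$ and $n$. Moreover, for $s>0$, the dual spaces $H^{-s}_{\rho^{(a,b)}}(I)$ and $H^{-s}_{(a,b)}(I)$, that is, the spaces of bounded linear functionals $F$ on $H^s_{\rho^{(a,b)}}(I)$ and on $H^s_{(a,b)}(I)$ with the dual norms $\sup_{g\ne 0}|F(g)|/\|g\|$, coincide, and their norms are equivalent. -/

import Mathlib

open MeasureTheory Set Filter
open scoped ENNReal NNReal

noncomputable section

namespace WeightedSobolev

/-! ### Weighted square sums and square integrals -/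

theorem l2_add_le {α : Type*} [MeasurableSpace α] (μ : Measure α) {w f g h : α → ℝ≥0∞}
    (hw : Measurable w) (hf : Measurable f) (hg : Measurable g) (hh : ∀ x, h x ≤ f x + g x) :
    (∫⁻ x, w x * h x ^ 2 ∂μ) ^ (1 / 2 : ℝ) ≤
      (∫⁻ x, w x * f x ^ 2 ∂μ) ^ (1 / 2 : ℝ) + (∫⁻ x, w x * g x ^ 2 ∂μ) ^ (1 / 2 : ℝ) := by
  have key : ∀ k : α → ℝ≥0∞, Measurable k →
      ∫⁻ x, w x * k x ^ 2 ∂μ = ∫⁻ x, k x ^ (2 : ℝ) ∂(μ.withDensity w) := by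
    intro k hk
    rw [lintegral_withDensity_eq_lintegral_mul _ hw (hk.pow_const _)]
    simp
  have h1 : (∫⁻ x, w x * h x ^ 2 ∂μ) ^ (1 / 2 : ℝ) ≤
      (∫⁻ x, w x * (f + g) x ^ 2 ∂μ) ^ (1 / 2 : ℝ) := by
    gcongr with x
    exact hh x
  refine h1.trans ?_
  rw [key _ (hf.add hg), key _ hf, key _ hg]
  exact ENNReal.lintegral_Lp_add_le hf.aemeasurable hg.aemeasurable one_le_two

theorem sq_mul_rpow_half (c A : ℝ≥0∞) : (c ^ 2 * A) ^ (1 / 2 : ℝ) = c * A ^ (1 / 2 : ℝ) := by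
  rw [ENNReal.mul_rpow_of_nonneg _ _ (by norm_num), ← ENNReal.rpow_natCast, ← ENNReal.rpow_mul]
  norm_num

theorem l2_smul_le {α : Type*} [MeasurableSpace α] (μ : Measure α) {w f h : α → ℝ≥0∞}
    {c : ℝ≥0∞} (hc : c ≠ ∞) (hh : ∀ x, h x ≤ c * f x) :
    (∫⁻ x, w x * h x ^ 2 ∂μ) ^ (1 / 2 : ℝ) ≤ c * (∫⁻ x, w x * f x ^ 2 ∂μ) ^ (1 / 2 : ℝ) := by
  rw [← sq_mul_rpow_half, ← lintegral_const_mul' _ _ (ENNReal.pow_ne_top hc)]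
  refine ENNReal.rpow_le_rpow (lintegral_mono fun x => ?_) (by norm_num)
  calc w x * h x ^ 2 ≤ w x * (c * f x) ^ 2 := by gcongr; exact hh x
    _ = c ^ 2 * (w x * f x ^ 2) := by ring

/-! ### Extended seminorms, their spaces and dual spaces -/

/-- A seminorm on a real vector space that may take the value `∞`. -/
structure ExtSeminorm (E : Type*) [AddCommGroup E] [Module ℝ E] where
  /-- the value at a vector -/
  toFun : E → ℝ≥0∞
  map_zero' : toFun 0 = 0
  map_add_le' : ∀ u v, toFun (u + v) ≤ toFun u + toFun v
  map_smul_le' : ∀ (c : ℝ) u, toFun (c • u) ≤ ‖c‖ₑ * toFun u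

namespace ExtSeminorm

variable {E : Type*} [AddCommGroup E] [Module ℝ E]

instance : CoeFun (ExtSeminorm E) (fun _ => E → ℝ≥0∞) := ⟨ExtSeminorm.toFun⟩

/-- The subspace of all vectors of finite norm. -/
def space (N : ExtSeminorm E) : Submodule ℝ E where
  carrier := {v | N v < ∞}
  zero_mem' := by simp [N.map_zero']
  add_mem' {u v} hu hv := (N.map_add_le' u v).trans_lt (ENNReal.add_lt_top.2 ⟨hu, hv⟩)
  smul_mem' c u hu := (N.map_smul_le' c u).trans_lt (ENNReal.mul_lt_top enorm_lt_top hu)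

/-- The dual norm `sup_g |F g| / N g` of a linear functional `F` defined on a subspace of `E`. -/
def dualNorm (N : ExtSeminorm E) (F : E →ₗ.[ℝ] ℝ) : ℝ≥0∞ :=
  ⨆ g : F.domain, ‖F g‖ₑ / N g

/-- The dual space of `N.space`: all bounded linear functionals with domain `N.space`. -/
def dual (N : ExtSeminorm E) : Set (E →ₗ.[ℝ] ℝ) :=
  {F | F.domain = N.space ∧ N.dualNorm F < ∞}

/-- The two spaces coincide and their norms are equivalent. -/
def SpacesCoincide (N₁ N₂ : ExtSeminorm E) : Prop :=
  N₁.space = N₂.space ∧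
    ∃ c C : ℝ≥0, 0 < c ∧ 0 < C ∧ ∀ v ∈ N₁.space, c * N₁ v ≤ N₂ v ∧ N₂ v ≤ C * N₁ v

/-- The two dual spaces coincide and their dual norms are equivalent. -/
def DualsCoincide (N₁ N₂ : ExtSeminorm E) : Prop :=
  N₁.dual = N₂.dual ∧
    ∃ c C : ℝ≥0, 0 < c ∧ 0 < C ∧ ∀ F ∈ N₁.dual,
      c * N₁.dualNorm F ≤ N₂.dualNorm F ∧ N₂.dualNorm F ≤ C * N₁.dualNorm F

/-! ### The K-method of interpolation -/

/-- Peetre's functional `K(t, u) = inf_v (‖u - v‖₀ + t ‖v‖₁)`, with `v` in the second space. -/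
def kFunctional (N₀ N₁ : ExtSeminorm E) (t : ℝ) (u : E) : ℝ≥0∞ :=
  ⨅ v ∈ N₁.space, (N₀ (u - v) + ENNReal.ofReal t * N₁ v)

theorem kFunctional_zero (N₀ N₁ : ExtSeminorm E) (t : ℝ) : kFunctional N₀ N₁ t 0 = 0 := by
  refine le_antisymm ?_ zero_le
  refine (iInf₂_le 0 N₁.space.zero_mem).trans ?_
  simp [N₀.map_zero', N₁.map_zero']

theorem kFunctional_add_le (N₀ N₁ : ExtSeminorm E) (t : ℝ) (u v : E) :
    kFunctional N₀ N₁ t (u + v) ≤ kFunctional N₀ N₁ t u + kFunctional N₀ N₁ t v := by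
  unfold kFunctional
  refine ENNReal.le_iInf₂_add_iInf₂ fun x hx y hy => ?_
  refine (iInf₂_le (x + y) (N₁.space.add_mem hx hy)).trans ?_
  calc N₀ (u + v - (x + y)) + ENNReal.ofReal t * N₁ (x + y)
      ≤ (N₀ (u - x) + N₀ (v - y)) + ENNReal.ofReal t * (N₁ x + N₁ y) := by
        have h : u + v - (x + y) = (u - x) + (v - y) := by abel
        rw [h]
        gcongr
        · exact N₀.map_add_le' _ _
        · exact N₁.map_add_le' _ _
    _ = _ := by ring

theorem kFunctional_smul_le (N₀ N₁ : ExtSeminorm E) (t : ℝ) (c : ℝ) (u : E) :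
    kFunctional N₀ N₁ t (c • u) ≤ ‖c‖ₑ * kFunctional N₀ N₁ t u := by
  by_cases hc : c = 0
  · subst hc
    refine (iInf₂_le 0 N₁.space.zero_mem).trans ?_
    simp [N₀.map_zero', N₁.map_zero']
  unfold kFunctional
  rw [ENNReal.mul_iInf_of_ne (enorm_ne_zero.2 hc) enorm_ne_top]
  refine le_iInf fun x => ?_
  rw [ENNReal.mul_iInf_of_ne (enorm_ne_zero.2 hc) enorm_ne_top]
  refine le_iInf fun hx => ?_
  refine (iInf₂_le (c • x) (N₁.space.smul_mem c hx)).trans ?_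
  rw [← smul_sub]
  calc N₀ (c • (u - x)) + ENNReal.ofReal t * N₁ (c • x)
      ≤ ‖c‖ₑ * N₀ (u - x) + ENNReal.ofReal t * (‖c‖ₑ * N₁ x) := by
        gcongr
        · exact N₀.map_smul_le' _ _
        · exact N₁.map_smul_le' _ _
    _ = _ := by ring

theorem kFunctional_measurable (N₀ N₁ : ExtSeminorm E) (u : E) :
    Measurable fun t => kFunctional N₀ N₁ t u := by
  apply Monotone.measurable
  intro s t hst
  refine iInf₂_mono fun v _ => ?_
  gcongr

/-- The norm `(∫_0^∞ t^(-2θ) K(t, u)² dt/t)^(1/2)` of the interpolation space `[N₀, N₁]_{θ,2}`. -/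
def interpolation (N₀ N₁ : ExtSeminorm E) (θ : ℝ) : ExtSeminorm E where
  toFun u := (∫⁻ t in Ioi (0 : ℝ),
    ENNReal.ofReal (t ^ (-2 * θ) / t) * kFunctional N₀ N₁ t u ^ 2) ^ (1 / 2 : ℝ)
  map_zero' := by simp [kFunctional_zero]
  map_add_le' u v := l2_add_le _ (by fun_prop) (kFunctional_measurable N₀ N₁ u)
    (kFunctional_measurable N₀ N₁ v) fun t => kFunctional_add_le N₀ N₁ t u v
  map_smul_le' c u := l2_smul_le _ enorm_ne_top fun t => kFunctional_smul_le N₀ N₁ t c u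

end ExtSeminorm

/-! ### Weighted spaces on the unit interval -/

/-- The weight `(1 - x)^a x^b`. -/
def weight (a b x : ℝ) : ℝ := (1 - x) ^ a * x ^ b

/-- The measure `(1 - x)^a x^b dx` on the interval `(0, 1)`. -/
def weightMeasure (a b : ℝ) : Measure ℝ :=
  (volume.restrict (Ioo 0 1)).withDensity fun x => ENNReal.ofReal (weight a b x)

/-- The weighted space `L²` on `(0, 1)` with weight `(1 - x)^a x^b`. -/
abbrev WeightedL2 (a b : ℝ) : Type := Lp ℝ 2 (weightMeasure a b)

/-- `g` is the `k`-th weak derivative of `v` on `(0, 1)`. -/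
def IsWeakDeriv (k : ℕ) (v g : ℝ → ℝ) : Prop :=
  LocallyIntegrableOn v (Ioo 0 1) ∧ LocallyIntegrableOn g (Ioo 0 1) ∧
    ∀ φ : ℝ → ℝ, ContDiff ℝ (⊤ : ℕ∞) φ → HasCompactSupport φ → tsupport φ ⊆ Ioo 0 1 →
      ∫ x in Ioo 0 1, v x * iteratedDeriv k φ x = (-1) ^ k * ∫ x in Ioo 0 1, g x * φ x

theorem IsWeakDeriv.integrable_mul {v ψ : ℝ → ℝ} {K : Set ℝ}
    (hv : LocallyIntegrableOn v (Ioo 0 1)) (hψ : Continuous ψ) (hK : IsCompact K)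
    (hsub : K ⊆ Ioo 0 1) (hsupp : Function.support ψ ⊆ K) :
    Integrable (fun x => v x * ψ x) (volume.restrict (Ioo 0 1)) := by
  have h1 : IntegrableOn (fun x => v x * ψ x) K :=
    (hv.integrableOn_compact_subset hsub hK).mul_continuousOn hψ.continuousOn hK
  refine Integrable.integrableOn ((integrableOn_iff_integrable_of_support_subset ?_).1 h1)
  intro x hx
  apply hsupp
  intro h
  exact hx (by simp [h])

theorem support_iteratedDeriv_subset (k : ℕ) (φ : ℝ → ℝ) :
    Function.support (iteratedDeriv k φ) ⊆ tsupport φ := by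
  intro x hx
  apply support_iteratedFDeriv_subset (𝕜 := ℝ) k
  intro h
  exact hx (by simp [iteratedDeriv, h])

theorem IsWeakDeriv.zero (k : ℕ) : IsWeakDeriv k 0 0 :=
  ⟨fun _ _ => integrableAtFilter_zero, fun _ _ => integrableAtFilter_zero, by simp⟩

theorem IsWeakDeriv.add {k : ℕ} {u v f g : ℝ → ℝ} (hu : IsWeakDeriv k u f)
    (hv : IsWeakDeriv k v g) : IsWeakDeriv k (u + v) (f + g) := by
  refine ⟨hu.1.add hv.1, hu.2.1.add hv.2.1, fun φ h1 h2 h3 => ?_⟩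
  have c1 : Continuous (iteratedDeriv k φ) := h1.continuous_iteratedDeriv k (mod_cast le_top)
  simp only [Pi.add_apply, add_mul]
  rw [integral_add
      (integrable_mul hu.1 c1 h2 h3 (support_iteratedDeriv_subset k φ))
      (integrable_mul hv.1 c1 h2 h3 (support_iteratedDeriv_subset k φ)),
    integral_add
      (integrable_mul hu.2.1 h1.continuous h2 h3 (subset_tsupport φ))
      (integrable_mul hv.2.1 h1.continuous h2 h3 (subset_tsupport φ)),
    hu.2.2 φ h1 h2 h3, hv.2.2 φ h1 h2 h3, mul_add]

theorem IsWeakDeriv.smul {k : ℕ} {u f : ℝ → ℝ} (hu : IsWeakDeriv k u f) (c : ℝ) :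
    IsWeakDeriv k (c • u) (c • f) := by
  refine ⟨hu.1.smul c, hu.2.1.smul c, fun φ h1 h2 h3 => ?_⟩
  simp only [Pi.smul_apply, smul_eq_mul, mul_assoc, integral_const_mul]
  rw [hu.2.2 φ h1 h2 h3]
  ring

theorem IsWeakDeriv.congr {k : ℕ} {u v f : ℝ → ℝ} (hu : IsWeakDeriv k u f)
    (h : u =ᵐ[volume.restrict (Ioo 0 1)] v) : IsWeakDeriv k v f := by
  refine ⟨?_, hu.2.1, fun φ h1 h2 h3 => ?_⟩
  · rw [locallyIntegrableOn_iff (isOpen_Ioo.isLocallyClosed)]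
    intro K hK hc
    exact (hu.1.integrableOn_compact_subset hK hc).congr (ae_restrict_of_ae_restrict_of_subset hK h)
  · rw [← hu.2.2 φ h1 h2 h3]
    refine integral_congr_ae ?_
    filter_upwards [h] with x hx
    rw [hx]

theorem weight_measurable (a b : ℝ) : Measurable (weight a b) := by
  unfold weight
  fun_prop

theorem weight_pos (a b : ℝ) {x : ℝ} (hx : x ∈ Ioo (0 : ℝ) 1) : 0 < weight a b x :=
  mul_pos (Real.rpow_pos_of_pos (by linarith [hx.2]) _) (Real.rpow_pos_of_pos hx.1 _)

theorem ae_eq_of_ae_eq_weightMeasure {a b : ℝ} {u v : ℝ → ℝ}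
    (h : u =ᵐ[weightMeasure a b] v) : u =ᵐ[volume.restrict (Ioo 0 1)] v := by
  refine (withDensity_absolutelyContinuous' ?_ ?_).ae_le h
  · exact (weight_measurable a b).ennreal_ofReal.aemeasurable
  · refine (ae_restrict_mem measurableSet_Ioo).mono fun x hx => ?_
    simpa using weight_pos a b hx

theorem IsWeakDeriv.aestronglyMeasurable {a b : ℝ} {k : ℕ} {u f : ℝ → ℝ}
    (hu : IsWeakDeriv k u f) : AEStronglyMeasurable f (weightMeasure a b) :=
  hu.2.1.aestronglyMeasurable.mono_ac (withDensity_absolutelyContinuous _ _)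

/-- The weighted norm `‖D^k v‖` in `L²` with weight `(1 - x)^(a+k) x^(b+k)`; it is `∞` if `v` has no
`k`-th weak derivative. (All weak derivatives of `v` agree almost everywhere on `(0, 1)`, so the
infimum is over equal values.) -/
def derivNorm (a b : ℝ) (k : ℕ) (v : ℝ → ℝ) : ℝ≥0∞ :=
  ⨅ (g : ℝ → ℝ) (_ : IsWeakDeriv k v g), eLpNorm g 2 (weightMeasure (a + k) (b + k))

theorem derivNorm_congr_le (a b : ℝ) (k : ℕ) {u v : ℝ → ℝ}
    (h : u =ᵐ[volume.restrict (Ioo 0 1)] v) : derivNorm a b k v ≤ derivNorm a b k u :=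
  le_iInf₂ fun g hg => iInf₂_le g (hg.congr h)

theorem derivNorm_zero (a b : ℝ) (k : ℕ) : derivNorm a b k 0 = 0 :=
  le_antisymm ((iInf₂_le 0 (IsWeakDeriv.zero k)).trans (by simp)) zero_le

theorem derivNorm_add_le (a b : ℝ) (k : ℕ) (u v : ℝ → ℝ) :
    derivNorm a b k (u + v) ≤ derivNorm a b k u + derivNorm a b k v :=
  ENNReal.le_iInf₂_add_iInf₂ fun f hf g hg => (iInf₂_le (f + g) (hf.add hg)).trans
    (eLpNorm_add_le hf.aestronglyMeasurable hg.aestronglyMeasurable one_le_two)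

theorem derivNorm_smul_le (a b : ℝ) (k : ℕ) (c : ℝ) (u : ℝ → ℝ) :
    derivNorm a b k (c • u) ≤ ‖c‖ₑ * derivNorm a b k u := by
  by_cases hc : c = 0
  · subst hc
    simp [derivNorm_zero]
  unfold derivNorm
  rw [ENNReal.mul_iInf_of_ne (enorm_ne_zero.2 hc) enorm_ne_top]
  refine le_iInf fun g => ?_
  rw [ENNReal.mul_iInf_of_ne (enorm_ne_zero.2 hc) enorm_ne_top]
  refine le_iInf fun hg => (iInf₂_le (c • g) (hg.smul c)).trans ?_
  exact eLpNorm_const_smul_le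

/-- The norm `(∑_{k ≤ n} ‖D^k v‖²)^(1/2)`, the `k`-th term weighted by `(1 - x)^(a+k) x^(b+k)`. -/
def sobolevNorm (a b : ℝ) (n : ℕ) : ExtSeminorm (WeightedL2 a b) where
  toFun v := (∑ k ∈ Finset.range (n + 1), derivNorm a b k v ^ 2) ^ (1 / 2 : ℝ)
  map_zero' := by
    have h : ∀ k, derivNorm a b k ((0 : WeightedL2 a b) : ℝ → ℝ) = 0 := fun k =>
      le_antisymm ((derivNorm_congr_le a b k
        (ae_eq_of_ae_eq_weightMeasure (Lp.coeFn_zero ℝ 2 _)).symm).trans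
          (derivNorm_zero a b k).le) zero_le
    simp only [h]
    simp
  map_add_le' u v := by
    have h : ∀ k, derivNorm a b k (u + v : WeightedL2 a b) ≤
        derivNorm a b k u + derivNorm a b k v := fun k =>
      (derivNorm_congr_le a b k (ae_eq_of_ae_eq_weightMeasure (Lp.coeFn_add u v)).symm).trans
        (derivNorm_add_le a b k u v)
    refine (ENNReal.rpow_le_rpow (Finset.sum_le_sum fun k _ => pow_le_pow_left₀ zero_le (h k) 2)
      (by norm_num)).trans ?_
    have := ENNReal.Lp_add_le (Finset.range (n + 1)) (fun k => derivNorm a b k u)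
      (fun k => derivNorm a b k v) (p := 2) one_le_two
    simpa only [ENNReal.rpow_two] using this
  map_smul_le' c u := by
    have h : ∀ k, derivNorm a b k (c • u : WeightedL2 a b) ≤ ‖c‖ₑ * derivNorm a b k u := fun k =>
      (derivNorm_congr_le a b k (ae_eq_of_ae_eq_weightMeasure (Lp.coeFn_smul c u)).symm).trans
        (derivNorm_smul_le a b k c u)
    rw [← sq_mul_rpow_half, Finset.mul_sum]
    refine ENNReal.rpow_le_rpow (Finset.sum_le_sum fun k _ => ?_) (by norm_num)
    rw [← mul_pow]
    exact pow_le_pow_left₀ zero_le (h k) 2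

/-! ### Jacobi coefficients -/

/-- The Jacobi polynomial `P_n^{(a,b)}`. -/
def jacobiP (a b : ℝ) (n : ℕ) (t : ℝ) : ℝ :=
  ∑ m ∈ Finset.range (n + 1),
    1 / 2 ^ n * Ring.choose (n + a) m * Ring.choose (n + b) (n - m) *
      (t - 1) ^ (n - m) * (t + 1) ^ m

/-- The Jacobi polynomial transformed to the interval `(0, 1)`. -/
def jacobiG (a b : ℝ) (n : ℕ) (x : ℝ) : ℝ := jacobiP a b n (2 * x - 1)

/-- The transformed Jacobi polynomial, normalized in the weighted `L²` space. -/
def jacobiGNormalized (a b : ℝ) (n : ℕ) (x : ℝ) : ℝ :=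
  jacobiG a b n x / √(∫ y in Ioo 0 1, weight a b y * jacobiG a b n y ^ 2)

/-- The `j`-th Jacobi coefficient of `v`. -/
def jacobiCoeff (a b : ℝ) (j : ℕ) (v : ℝ → ℝ) : ℝ :=
  ∫ x in Ioo 0 1, weight a b x * v x * jacobiGNormalized a b j x

theorem integrable_weight {a b : ℝ} (ha : -1 < a) (hb : -1 < b) :
    Integrable (weight a b) (volume.restrict (Ioo 0 1)) := by
  have h := Complex.betaIntegral_convergent (u := ((b + 1 : ℝ) : ℂ)) (v := ((a + 1 : ℝ) : ℂ))
    (by simp; linarith) (by simp; linarith)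
  rw [intervalIntegrable_iff_integrableOn_Ioo_of_le zero_le_one] at h
  refine (h.norm).congr ?_
  refine (ae_restrict_mem measurableSet_Ioo).mono fun x hx => ?_
  have h1 : (1 - (x : ℂ)) = ((1 - x : ℝ) : ℂ) := by push_cast; rfl
  have h2 : 0 < 1 - x := by linarith [hx.2]
  simp only [norm_mul]
  rw [h1, Complex.norm_cpow_eq_rpow_re_of_pos hx.1, Complex.norm_cpow_eq_rpow_re_of_pos h2]
  simp [weight, mul_comm]

theorem weightMeasure_finite {a b : ℝ} (ha : -1 < a) (hb : -1 < b) :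
    IsFiniteMeasure (weightMeasure a b) :=
  isFiniteMeasure_withDensity_ofReal (integrable_weight ha hb).2

theorem jacobiGNormalized_continuous (a b : ℝ) (n : ℕ) : Continuous (jacobiGNormalized a b n) := by
  unfold jacobiGNormalized jacobiG jacobiP
  fun_prop

theorem jacobiCoeff_integrable {a b : ℝ} (ha : -1 < a) (hb : -1 < b) (j : ℕ)
    (v : WeightedL2 a b) :
    Integrable (fun x => weight a b x * v x * jacobiGNormalized a b j x)
      (volume.restrict (Ioo 0 1)) := by
  have := weightMeasure_finite ha hb
  have hc := jacobiGNormalized_continuous a b j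
  obtain ⟨C, hC⟩ := isCompact_Icc.exists_bound_of_continuousOn (s := Icc (0 : ℝ) 1) hc.continuousOn
  have hG : MemLp (jacobiGNormalized a b j) 2 (weightMeasure a b) := by
    refine MemLp.of_bound hc.aestronglyMeasurable C ?_
    refine (withDensity_absolutelyContinuous _ _).ae_le ?_
    exact (ae_restrict_mem measurableSet_Ioo).mono fun x hx => hC x (Ioo_subset_Icc_self hx)
  have h := (Lp.memLp v).integrable_mul hG
  have h' := (integrable_withDensity_iff_integrable_smul'
    (weight_measurable a b).ennreal_ofReal (by simp)).1 h
  refine h'.congr ((ae_restrict_mem measurableSet_Ioo).mono fun x hx => ?_)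
  simp [ENNReal.toReal_ofReal (weight_pos a b hx).le, mul_assoc]

theorem jacobiCoeff_congr {a b : ℝ} (j : ℕ) {u v : ℝ → ℝ} (h : u =ᵐ[weightMeasure a b] v) :
    jacobiCoeff a b j u = jacobiCoeff a b j v := by
  refine integral_congr_ae ?_
  filter_upwards [ae_eq_of_ae_eq_weightMeasure h] with x hx
  rw [hx]

theorem jacobiCoeff_add {a b : ℝ} (ha : -1 < a) (hb : -1 < b) (j : ℕ) (u v : WeightedL2 a b) :
    jacobiCoeff a b j (u + v : WeightedL2 a b) = jacobiCoeff a b j u + jacobiCoeff a b j v := by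
  rw [jacobiCoeff_congr j (Lp.coeFn_add u v)]
  unfold jacobiCoeff
  rw [← integral_add (jacobiCoeff_integrable ha hb j u) (jacobiCoeff_integrable ha hb j v)]
  congr 1
  ext x
  simp only [Pi.add_apply]
  ring

theorem jacobiCoeff_smul {a b : ℝ} (j : ℕ) (c : ℝ) (u : WeightedL2 a b) :
    jacobiCoeff a b j (c • u : WeightedL2 a b) = c * jacobiCoeff a b j u := by
  rw [jacobiCoeff_congr j (Lp.coeFn_smul c u)]
  unfold jacobiCoeff
  rw [← integral_const_mul]
  congr 1
  ext x
  simp only [Pi.smul_apply, smul_eq_mul]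
  ring

theorem jacobi_term (s : ℝ) (j : ℕ) (r : ℝ) :
    ENNReal.ofReal ((1 + (j : ℝ) ^ 2) ^ s * r ^ 2) =
      ENNReal.ofReal ((1 + (j : ℝ) ^ 2) ^ s) * ‖r‖ₑ ^ 2 := by
  rw [ENNReal.ofReal_mul (by positivity), ← sq_abs r, ENNReal.ofReal_pow (abs_nonneg r),
    Real.enorm_eq_ofReal_abs]

/-- The norm `(∑_j (1 + j²)^s v_j²)^(1/2)`, where `v_j` are the Jacobi coefficients of `v`. -/
def jacobiNorm {a b : ℝ} (ha : -1 < a) (hb : -1 < b) (s : ℝ) : ExtSeminorm (WeightedL2 a b) where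
  toFun v := (∑' j : ℕ, ENNReal.ofReal ((1 + (j : ℝ) ^ 2) ^ s * jacobiCoeff a b j v ^ 2))
    ^ (1 / 2 : ℝ)
  map_zero' := by
    have h : ∀ j, jacobiCoeff a b j ((0 : WeightedL2 a b) : ℝ → ℝ) = 0 := fun j => by
      rw [jacobiCoeff_congr j (Lp.coeFn_zero ℝ 2 _)]
      simp [jacobiCoeff]
    simp only [h]
    simp
  map_add_le' u v := by
    simp only [jacobi_term, jacobiCoeff_add ha hb, ← lintegral_count]
    exact l2_add_le _ .of_discrete .of_discrete .of_discrete fun j => enorm_add_le _ _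
  map_smul_le' c u := by
    simp only [jacobi_term, jacobiCoeff_smul, ← lintegral_count]
    exact l2_smul_le _ enorm_ne_top fun j => (enorm_mul _ _).le

end WeightedSobolev

end

/-!
The normalized Jacobi polynomials `G̃_j^{(a,b)}` form a Hilbert basis of the weighted `L²` space,
and differentiation is a weighted shift between these bases: `(G̃_{n+1}^{(a,b)})' =
√((n+1)(n+a+b+2)) G̃_n^{(a+1,b+1)}`. Both this identity and its adjoint `(ρ^{(a+1,b+1)}
G̃_n^{(a+1,b+1)})' = -√((n+1)(n+a+b+2)) ρ^{(a,b)} G̃_{n+1}^{(a,b)}` come from comparing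
coefficients in the homogeneous basis `(x-1)^k x^m` (`derivative_jacobiPoly_succ`,
`jacobiPoly_pearson`). Orthogonality and the ratio of the norms follow by integration by parts,
completeness by Weierstrass' theorem (`eq_zero_of_jacobiCoeff_eq_zero`).

The weak derivative acts on coefficients by the same shift. If `v` has weak derivatives in the
weighted spaces, testing with the Jacobi polynomials times weight and cutoff gives their
coefficients (`jacobiCoeff_of_isWeakDeriv_one`). Conversely, if the shifted sequence is square
summable, Parseval's identity shows that the function with these coefficients is a weak
derivative (`isWeakDeriv_of_jacobiCoeff`). Therefore the Sobolev norm of order `n` is exactly a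
weighted `ℓ²` norm of the Jacobi coefficients (`sobolevNorm_eq`), with a weight between two
multiples of `(1 + j²)^n` (`exists_sobolevEigen_equiv`). This is the claim for integer orders.

For two weighted `ℓ²` norms with weights `w₀` and `w₁`, truncating the coefficients shows that
`K(t, u)²` is comparable to the squared `ℓ²` norm with weight `min(w₀, t² w₁)`. Integrating this
in `t` term by term gives the weight `w₀^(1-θ) w₁^θ` (`interpolation_diag_equiv`), which is
comparable to `(1 + j²)^s`. Spaces with equivalent norms have the same bounded functionals, with
equivalent dual norms (`ExtSeminorm.coincide_of_le`).
-/

noncomputable section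

namespace WeightedSobolev

open scoped Topology

/-! ### Jacobi polynomials -/

theorem succ_mul_ringChoose_succ (r : ℝ) (m : ℕ) :
    ((m : ℝ) + 1) * Ring.choose r (m + 1) = (r - m) * Ring.choose r m := by
  rw [Ring.choose_eq_smul, Ring.choose_eq_smul, descPochhammer_succ_right]
  simp only [Polynomial.smeval_mul, Polynomial.smeval_sub, Polynomial.smeval_X,
    Polynomial.smeval_natCast, Nat.factorial_succ, smul_eq_mul]
  have h1 : ((m : ℝ) + 1) ≠ 0 := by positivity
  have h2 : ((m.factorial : ℕ) : ℝ) ≠ 0 := by positivity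
  push_cast
  field_simp
  simp

/-- The Jacobi polynomial on `(0, 1)` as a formal polynomial. In the homogeneous basis
`(X - 1)^k X^m`, with `m + k = n`, the powers of two of the classical formula cancel. -/
def jacobiPoly (a b : ℝ) (n : ℕ) : Polynomial ℝ :=
  ∑ p ∈ Finset.HasAntidiagonal.antidiagonal n,
    Polynomial.C (Ring.choose (n + a) p.1 * Ring.choose (n + b) p.2) *
      ((Polynomial.X - 1) ^ p.2 * Polynomial.X ^ p.1)

theorem eval_jacobiPoly (a b : ℝ) (n : ℕ) (x : ℝ) :
    (jacobiPoly a b n).eval x = jacobiG a b n x := by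
  rw [jacobiPoly, Polynomial.eval_finsetSum, Finset.Nat.sum_antidiagonal_eq_sum_range_succ_mk,
    jacobiG, jacobiP]
  refine Finset.sum_congr rfl fun m hm => ?_
  have hm' : n - m + m = n := Nat.sub_add_cancel (Nat.lt_succ_iff.1 (Finset.mem_range.1 hm))
  have h1 : (2 * x - 1 - 1) ^ (n - m) = 2 ^ (n - m) * (x - 1) ^ (n - m) := by
    rw [← mul_pow]; ring
  have h2 : (2 * x - 1 + 1) ^ m = 2 ^ m * x ^ m := by
    rw [← mul_pow]; ring
  have h3 : (2 : ℝ) ^ n = 2 ^ (n - m) * 2 ^ m := by rw [← pow_add, hm']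
  rw [h1, h2, h3]
  simp only [Polynomial.eval_mul, Polynomial.eval_C, Polynomial.eval_pow, Polynomial.eval_sub,
    Polynomial.eval_X, Polynomial.eval_one]
  field_simp

theorem derivative_sub_one_pow_mul_pow (m k : ℕ) :
    Polynomial.derivative ((Polynomial.X - 1) ^ k * Polynomial.X ^ m : Polynomial ℝ) =
      (k : Polynomial ℝ) * ((Polynomial.X - 1) ^ (k - 1) * Polynomial.X ^ m) +
        (m : Polynomial ℝ) * ((Polynomial.X - 1) ^ k * Polynomial.X ^ (m - 1)) := by
  simp [Polynomial.derivative_mul, Polynomial.derivative_pow]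
  ring

theorem derivative_jacobiPoly_succ (a b : ℝ) (n : ℕ) :
    Polynomial.derivative (jacobiPoly a b (n + 1)) =
      Polynomial.C (n + a + b + 2) * jacobiPoly (a + 1) (b + 1) n := by
  have ea : ((n + 1 : ℕ) : ℝ) + a = n + (a + 1) := by push_cast; ring
  have eb : ((n + 1 : ℕ) : ℝ) + b = n + (b + 1) := by push_cast; ring
  rw [jacobiPoly, jacobiPoly, Polynomial.derivative_sum, Finset.mul_sum]
  simp only [Polynomial.derivative_C_mul, derivative_sub_one_pow_mul_pow, mul_add,
    Finset.sum_add_distrib]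
  rw [Finset.Nat.sum_antidiagonal_succ', Finset.Nat.sum_antidiagonal_succ]
  simp only [Nat.cast_zero, zero_mul, mul_zero, zero_add, Nat.add_sub_cancel, ea, eb]
  rw [← Finset.sum_add_distrib]
  refine Finset.sum_congr rfl fun p hp => ?_
  have hn : (n : ℝ) = p.1 + p.2 := by
    rw [← Finset.HasAntidiagonal.mem_antidiagonal.1 hp]; push_cast; ring
  have h1 := succ_mul_ringChoose_succ (n + (a + 1)) p.1
  have h2 := succ_mul_ringChoose_succ (n + (b + 1)) p.2
  have key : Ring.choose (n + (a + 1)) p.1 * Ring.choose (n + (b + 1)) (p.2 + 1) * (p.2 + 1) +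
      Ring.choose (n + (a + 1)) (p.1 + 1) * Ring.choose (n + (b + 1)) p.2 * (p.1 + 1) =
      (n + a + b + 2) * (Ring.choose (n + (a + 1)) p.1 * Ring.choose (n + (b + 1)) p.2) := by
    linear_combination Ring.choose (n + (a + 1)) p.1 * h2 + Ring.choose (n + (b + 1)) p.2 * h1
      + Ring.choose (n + (a + 1)) p.1 * Ring.choose (n + (b + 1)) p.2 * hn
  have key' := congrArg Polynomial.C key
  simp only [map_add, map_mul, map_natCast, map_one] at key' ⊢
  push_cast
  linear_combination ((Polynomial.X - 1) ^ p.2 * Polynomial.X ^ p.1) * key'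

/-- The Pearson-type identity behind Rodrigues' formula: it says that
`(ρ^{(a+1,b+1)} G_n^{(a+1,b+1)})' = -(n+1) ρ^{(a,b)} G_{n+1}^{(a,b)}`. -/
theorem jacobiPoly_pearson (a b : ℝ) (n : ℕ) :
    Polynomial.X * (1 - Polynomial.X) * Polynomial.derivative (jacobiPoly (a + 1) (b + 1) n) +
      (Polynomial.C (b + 1) * (1 - Polynomial.X) - Polynomial.C (a + 1) * Polynomial.X) *
        jacobiPoly (a + 1) (b + 1) n =
      -((n + 1 : ℕ) : Polynomial ℝ) * jacobiPoly a b (n + 1) := by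
  have ea : ((n + 1 : ℕ) : ℝ) + a = n + (a + 1) := by push_cast; ring
  have eb : ((n + 1 : ℕ) : ℝ) + b = n + (b + 1) := by push_cast; ring
  have hR : ((n + 1 : ℕ) : Polynomial ℝ) * jacobiPoly a b (n + 1) =
      ∑ p ∈ Finset.HasAntidiagonal.antidiagonal n,
        (Polynomial.C (((p.1 : ℝ) + 1) * Ring.choose (n + (a + 1)) (p.1 + 1) *
            Ring.choose (n + (b + 1)) p.2) *
          ((Polynomial.X - 1) ^ p.2 * Polynomial.X ^ (p.1 + 1)) +
        Polynomial.C (Ring.choose (n + (a + 1)) p.1 *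
            (((p.2 : ℝ) + 1) * Ring.choose (n + (b + 1)) (p.2 + 1))) *
          ((Polynomial.X - 1) ^ (p.2 + 1) * Polynomial.X ^ p.1)) := by
    have hsplit : ((n + 1 : ℕ) : Polynomial ℝ) * jacobiPoly a b (n + 1) =
        ∑ p ∈ Finset.HasAntidiagonal.antidiagonal (n + 1), Polynomial.C ((p.1 : ℝ) *
            Ring.choose (n + (a + 1)) p.1 * Ring.choose (n + (b + 1)) p.2) *
            ((Polynomial.X - 1) ^ p.2 * Polynomial.X ^ p.1) +
        ∑ p ∈ Finset.HasAntidiagonal.antidiagonal (n + 1),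
          Polynomial.C
            (Ring.choose (n + (a + 1)) p.1 * ((p.2 : ℝ) * Ring.choose (n + (b + 1)) p.2)) *
            ((Polynomial.X - 1) ^ p.2 * Polynomial.X ^ p.1) := by
      rw [jacobiPoly, Finset.mul_sum, ← Finset.sum_add_distrib]
      refine Finset.sum_congr rfl fun p hp => ?_
      rw [← Finset.HasAntidiagonal.mem_antidiagonal.1 hp] at ea eb ⊢
      rw [ea, eb]
      simp only [map_mul, map_natCast]
      push_cast
      ring
    rw [hsplit, Finset.Nat.sum_antidiagonal_succ, Finset.Nat.sum_antidiagonal_succ',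
      Finset.sum_add_distrib]
    simp
  rw [neg_mul, hR, jacobiPoly, Polynomial.derivative_sum, Finset.mul_sum, Finset.mul_sum,
    ← Finset.sum_add_distrib, ← Finset.sum_neg_distrib]
  refine Finset.sum_congr rfl fun p hp => ?_
  have hn : (n : ℝ) = p.1 + p.2 := by
    rw [← Finset.HasAntidiagonal.mem_antidiagonal.1 hp]; push_cast; ring
  rw [succ_mul_ringChoose_succ, succ_mul_ringChoose_succ]
  have hd : Polynomial.X * (1 - Polynomial.X) * Polynomial.derivative
      (((Polynomial.X - 1) ^ p.2 * Polynomial.X ^ p.1 : Polynomial ℝ)) =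
      -((p.2 : Polynomial ℝ) * Polynomial.X + (p.1 : Polynomial ℝ) * (Polynomial.X - 1)) *
        ((Polynomial.X - 1) ^ p.2 * Polynomial.X ^ p.1) := by
    obtain ⟨m, k⟩ := p
    rw [derivative_sub_one_pow_mul_pow]
    rcases m with - | m <;> rcases k with - | k <;> simp [pow_succ] <;> ring
  rw [Polynomial.derivative_C_mul]
  have e1 : (n : ℝ) + (a + 1) - p.1 = p.2 + (a + 1) := by rw [hn]; ring
  have e2 : (n : ℝ) + (b + 1) - p.2 = p.1 + (b + 1) := by rw [hn]; ring
  rw [e1, e2]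
  simp only [map_add, map_mul, map_natCast, map_one]
  linear_combination Polynomial.C (Ring.choose (n + (a + 1)) p.1) *
    Polynomial.C (Ring.choose (n + (b + 1)) p.2) * hd

theorem jacobiPoly_zero (a b : ℝ) : jacobiPoly a b 0 = 1 := by
  simp [jacobiPoly]

theorem natDegree_jacobiPoly {a b : ℝ} (ha : -1 < a) (hb : -1 < b) (n : ℕ) :
    (jacobiPoly a b n).natDegree = n := by
  induction n generalizing a b with
  | zero => simp [jacobiPoly_zero]
  | succ n ih =>
    have ih' := ih (a := a + 1) (b := b + 1) (by linarith) (by linarith)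
    have hc : (n + a + b + 2 : ℝ) ≠ 0 := by
      have : (0 : ℝ) ≤ n := n.cast_nonneg
      linarith
    have hne : jacobiPoly (a + 1) (b + 1) n ≠ 0 := by
      rcases n with - | n
      · simp [jacobiPoly_zero]
      · intro h
        simp [h] at ih'
    have h0 : Polynomial.derivative (jacobiPoly a b (n + 1)) ≠ 0 := by
      rw [derivative_jacobiPoly_succ]
      exact mul_ne_zero (by rwa [Ne, Polynomial.C_eq_zero]) hne
    have hpos : 0 < (jacobiPoly a b (n + 1)).natDegree :=
      Nat.pos_of_ne_zero fun h => h0 (Polynomial.derivative_of_natDegree_zero h)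
    have hd := Polynomial.natDegree_derivative (jacobiPoly a b (n + 1))
    rw [derivative_jacobiPoly_succ, Polynomial.natDegree_C_mul hc, ih'] at hd
    omega

theorem jacobiPoly_ne_zero {a b : ℝ} (ha : -1 < a) (hb : -1 < b) (n : ℕ) :
    jacobiPoly a b n ≠ 0 := by
  rcases n with - | n
  · simp [jacobiPoly_zero]
  · intro h
    have := natDegree_jacobiPoly ha hb (n + 1)
    simp [h] at this

theorem span_jacobiPoly {a b : ℝ} (ha : -1 < a) (hb : -1 < b) :
    Submodule.span ℝ (Set.range (jacobiPoly a b)) = ⊤ := by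
  let S : Polynomial.Sequence ℝ :=
    { elems' := jacobiPoly a b
      degree_eq' := fun i => by
        rw [Polynomial.degree_eq_natDegree (jacobiPoly_ne_zero ha hb i),
          natDegree_jacobiPoly ha hb] }
  exact S.span fun i => (Polynomial.leadingCoeff_ne_zero.2 (S.ne_zero i)).isUnit

theorem contDiff_jacobiG (a b : ℝ) (n : ℕ) {r : WithTop ℕ∞} : ContDiff ℝ r (jacobiG a b n) := by
  unfold jacobiG jacobiP
  fun_prop

theorem hasDerivAt_jacobiG (a b : ℝ) (n : ℕ) (x : ℝ) :
    HasDerivAt (jacobiG a b (n + 1)) ((n + a + b + 2) * jacobiG (a + 1) (b + 1) n x) x := by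
  have h := (jacobiPoly a b (n + 1)).hasDerivAt x
  rw [derivative_jacobiPoly_succ, Polynomial.eval_mul, Polynomial.eval_C, eval_jacobiPoly] at h
  exact h.congr_of_eventuallyEq (Eventually.of_forall fun y => (eval_jacobiPoly a b (n + 1) y).symm)

theorem jacobiG_zero (a b x : ℝ) : jacobiG a b 0 x = 1 := by
  simp [jacobiG, jacobiP]

theorem weight_add_one (a b : ℝ) {x : ℝ} (hx : x ∈ Ioo (0 : ℝ) 1) :
    weight (a + 1) (b + 1) x = (1 - x) * x * weight a b x := by
  have h : 0 < 1 - x := by linarith [hx.2]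
  rw [weight, weight, Real.rpow_add_one h.ne', Real.rpow_add_one hx.1.ne']
  ring

theorem hasDerivAt_weight (a b : ℝ) {x : ℝ} (hx : x ∈ Ioo (0 : ℝ) 1) :
    HasDerivAt (weight (a + 1) (b + 1))
      (((b + 1) * (1 - x) - (a + 1) * x) * weight a b x) x := by
  have h : 0 < 1 - x := by linarith [hx.2]
  have h1 : HasDerivAt (fun y : ℝ => (1 - y) ^ (a + 1)) (-1 * (a + 1) * (1 - x) ^ (a + 1 - 1)) x :=
    ((hasDerivAt_id x).const_sub 1).rpow_const (Or.inl h.ne')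
  have h2 : HasDerivAt (fun y : ℝ => y ^ (b + 1)) (1 * (b + 1) * x ^ (b + 1 - 1)) x :=
    (hasDerivAt_id x).rpow_const (Or.inl hx.1.ne')
  refine (h1.mul h2).congr_deriv ?_
  rw [weight, Real.rpow_add_one h.ne', Real.rpow_add_one hx.1.ne', add_sub_cancel_right,
    add_sub_cancel_right]
  ring

theorem hasDerivAt_weight_mul_jacobiG (a b : ℝ) (n : ℕ) {x : ℝ} (hx : x ∈ Ioo (0 : ℝ) 1) :
    HasDerivAt (fun y => weight (a + 1) (b + 1) y * jacobiG (a + 1) (b + 1) n y)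
      (-(n + 1) * (weight a b x * jacobiG a b (n + 1) x)) x := by
  have h := (jacobiPoly (a + 1) (b + 1) n).hasDerivAt x
  have h' : HasDerivAt (jacobiG (a + 1) (b + 1) n) _ x := h.congr_of_eventuallyEq
    (Eventually.of_forall fun y => (eval_jacobiPoly (a + 1) (b + 1) n y).symm)
  refine ((hasDerivAt_weight a b hx).mul h').congr_deriv ?_
  have hp := congrArg (Polynomial.eval x) (jacobiPoly_pearson a b n)
  simp only [Polynomial.eval_add, Polynomial.eval_mul, Polynomial.eval_sub, Polynomial.eval_X,
    Polynomial.eval_one, Polynomial.eval_C, Polynomial.eval_neg, Polynomial.eval_natCast,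
    eval_jacobiPoly] at hp
  push_cast at hp
  rw [weight_add_one a b hx]
  linear_combination weight a b x * hp

/-! ### Orthogonality of the Jacobi polynomials -/

theorem integrableOn_Ioo_mul_continuous {w f : ℝ → ℝ} (hw : IntegrableOn w (Ioo 0 1))
    (hf : Continuous f) : IntegrableOn (fun x => w x * f x) (Ioo 0 1) := by
  obtain ⟨C, hC⟩ := isCompact_Icc.exists_bound_of_continuousOn (s := Icc (0 : ℝ) 1) hf.continuousOn
  refine hw.mul_bdd (c := C) hf.aestronglyMeasurable ?_
  exact (ae_restrict_mem measurableSet_Ioo).mono fun x hx => hC x (Ioo_subset_Icc_self hx)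

theorem integrableOn_weight_mul {a b : ℝ} (ha : -1 < a) (hb : -1 < b) {f : ℝ → ℝ}
    (hf : Continuous f) : IntegrableOn (fun x => weight a b x * f x) (Ioo 0 1) :=
  integrableOn_Ioo_mul_continuous (integrable_weight ha hb) hf

theorem continuous_weight {a b : ℝ} (ha : 0 ≤ a) (hb : 0 ≤ b) : Continuous (weight a b) := by
  unfold weight
  exact ((continuous_const.sub continuous_id).rpow_const fun _ => Or.inr ha).mul
    (continuous_id.rpow_const fun _ => Or.inr hb)

/-- Integration by parts against a Jacobi polynomial; the boundary terms vanish because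
`ρ^{(a+1,b+1)}` is continuous and zero at both endpoints. -/
theorem integral_weight_mul_jacobiG_succ {a b : ℝ} (ha : -1 < a) (hb : -1 < b) (n : ℕ)
    {p p' : ℝ → ℝ} (hp : ∀ x, HasDerivAt p (p' x) x) (hp' : Continuous p') :
    (n + 1) * ∫ x in Ioo 0 1, weight a b x * (jacobiG a b (n + 1) x * p x) =
      ∫ x in Ioo 0 1, weight (a + 1) (b + 1) x * (jacobiG (a + 1) (b + 1) n x * p' x) := by
  have hpc : Continuous p := continuous_iff_continuousAt.2 fun x => (hp x).continuousAt
  have hG : ∀ α β : ℝ, ∀ k, Continuous (jacobiG α β k) := fun α β k =>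
    (contDiff_jacobiG α β k (r := 0)).continuous
  have i1 : IntegrableOn (fun x => weight a b x * (jacobiG a b (n + 1) x * p x)) (Ioo 0 1) :=
    integrableOn_weight_mul ha hb ((hG a b (n + 1)).mul hpc)
  have i2 : IntegrableOn (fun x => weight (a + 1) (b + 1) x *
      (jacobiG (a + 1) (b + 1) n x * p' x)) (Ioo 0 1) :=
    integrableOn_weight_mul (a := a + 1) (b := b + 1) (by linarith) (by linarith)
    ((hG (a + 1) (b + 1) n).mul hp')
  have h := intervalIntegral.integral_eq_sub_of_hasDerivAt_of_le
    (f := fun x => weight (a + 1) (b + 1) x * jacobiG (a + 1) (b + 1) n x * p x)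
    (f' := fun x => -(n + 1) * (weight a b x * (jacobiG a b (n + 1) x * p x)) +
      weight (a + 1) (b + 1) x * (jacobiG (a + 1) (b + 1) n x * p' x))
    zero_le_one
    (((continuous_weight (by linarith) (by linarith)).mul (hG _ _ _)).mul hpc).continuousOn
    (fun x hx => ((hasDerivAt_weight_mul_jacobiG a b n hx).mul (hp x)).congr_deriv (by ring))
    ((intervalIntegrable_iff_integrableOn_Ioo_of_le zero_le_one).2 ((i1.const_mul _).add i2))
  rw [intervalIntegral.integral_of_le zero_le_one, integral_Ioc_eq_integral_Ioo] at h
  rw [integral_add (i1.const_mul _) i2, integral_const_mul] at h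
  have w1 : weight (a + 1) (b + 1) 1 = 0 := by
    simp [weight, Real.zero_rpow (show a + 1 ≠ 0 by linarith)]
  have w0 : weight (a + 1) (b + 1) 0 = 0 := by
    simp [weight, Real.zero_rpow (show b + 1 ≠ 0 by linarith)]
  simp only [w0, w1, zero_mul, sub_zero] at h
  linarith

theorem integral_weight_mul_jacobiG_succ_mul_jacobiG_zero {a b : ℝ} (ha : -1 < a) (hb : -1 < b)
    (n : ℕ) : ∫ x in Ioo 0 1, weight a b x * (jacobiG a b (n + 1) x * jacobiG a b 0 x) = 0 := by
  have h := integral_weight_mul_jacobiG_succ ha hb n (p := fun _ => 1) (p' := fun _ => 0)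
    (fun x => hasDerivAt_const x 1) continuous_const
  simp only [mul_zero, integral_zero] at h
  simp only [jacobiG_zero]
  exact (mul_eq_zero.1 h).resolve_left (by positivity)

theorem integral_weight_mul_jacobiG_mul_jacobiG_of_ne {a b : ℝ} (ha : -1 < a) (hb : -1 < b)
    {n i : ℕ} (h : n ≠ i) :
    ∫ x in Ioo 0 1, weight a b x * (jacobiG a b n x * jacobiG a b i x) = 0 := by
  induction n generalizing a b i with
  | zero =>
    rcases i with - | i
    · exact absurd rfl h
    · simpa only [mul_comm (jacobiG a b 0 _)] using
        integral_weight_mul_jacobiG_succ_mul_jacobiG_zero ha hb i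
  | succ n ih =>
    rcases i with - | i
    · exact integral_weight_mul_jacobiG_succ_mul_jacobiG_zero ha hb n
    · have h1 := integral_weight_mul_jacobiG_succ ha hb n (hasDerivAt_jacobiG a b i)
        (continuous_const.mul (contDiff_jacobiG _ _ i (r := 0)).continuous)
      have h2 := ih (a := a + 1) (b := b + 1) (i := i) (by linarith) (by linarith)
        (fun e => h (by rw [e]))
      have h3 : ∀ x, weight (a + 1) (b + 1) x * (jacobiG (a + 1) (b + 1) n x *
          ((i + a + b + 2) * jacobiG (a + 1) (b + 1) i x)) = (i + a + b + 2) *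
          (weight (a + 1) (b + 1) x *
            (jacobiG (a + 1) (b + 1) n x * jacobiG (a + 1) (b + 1) i x)) :=
        fun x => by ring
      simp only [h3, integral_const_mul, h2, mul_zero] at h1
      exact (mul_eq_zero.1 h1).resolve_left (by positivity)

/-- The squared norm of the Jacobi polynomial `G_n` in the weighted `L²` space. -/
def jacobiSq (a b : ℝ) (n : ℕ) : ℝ := ∫ y in Ioo 0 1, weight a b y * jacobiG a b n y ^ 2

theorem jacobiSq_succ {a b : ℝ} (ha : -1 < a) (hb : -1 < b) (n : ℕ) :
    (n + 1) * jacobiSq a b (n + 1) = (n + a + b + 2) * jacobiSq (a + 1) (b + 1) n := by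
  have h := integral_weight_mul_jacobiG_succ ha hb n (hasDerivAt_jacobiG a b n)
    (continuous_const.mul (contDiff_jacobiG _ _ n (r := 0)).continuous)
  simp only [jacobiSq, sq]
  rw [h, ← integral_const_mul]
  congr 1
  ext x
  ring

theorem jacobiSq_pos {a b : ℝ} (ha : -1 < a) (hb : -1 < b) (n : ℕ) : 0 < jacobiSq a b n := by
  induction n generalizing a b with
  | zero =>
    simp only [jacobiSq, jacobiG_zero, one_pow, mul_one]
    refine (setIntegral_pos_iff_support_of_nonneg_ae ?_ (integrable_weight ha hb)).2 ?_
    · exact (ae_restrict_mem measurableSet_Ioo).mono fun x hx => (weight_pos a b hx).le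
    · have : Function.support (weight a b) ∩ Ioo 0 1 = Ioo 0 1 :=
        inter_eq_right.2 fun x hx => (weight_pos a b hx).ne'
      rw [this]
      simp
  | succ n ih =>
    have h1 := ih (a := a + 1) (b := b + 1) (by linarith) (by linarith)
    have h2 : (0 : ℝ) < n + a + b + 2 := by
      have : (0 : ℝ) ≤ n := n.cast_nonneg
      linarith
    have h3 : (0 : ℝ) < (n + 1) * jacobiSq a b (n + 1) := by
      rw [jacobiSq_succ ha hb]
      positivity
    exact pos_of_mul_pos_right h3 (by positivity)

theorem jacobiGNormalized_eq (a b : ℝ) (n : ℕ) (x : ℝ) :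
    jacobiGNormalized a b n x = jacobiG a b n x / √(jacobiSq a b n) := rfl

theorem integral_weight_mul_jacobiGNormalized {a b : ℝ} (ha : -1 < a) (hb : -1 < b) (n i : ℕ) :
    ∫ x in Ioo 0 1, weight a b x * (jacobiGNormalized a b n x * jacobiGNormalized a b i x) =
      if n = i then 1 else 0 := by
  have h : ∀ x, weight a b x * (jacobiGNormalized a b n x * jacobiGNormalized a b i x) =
      (√(jacobiSq a b n) * √(jacobiSq a b i))⁻¹ *
        (weight a b x * (jacobiG a b n x * jacobiG a b i x)) := by
    intro x
    rw [jacobiGNormalized_eq, jacobiGNormalized_eq, div_mul_div_comm, div_eq_mul_inv]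
    ring
  simp only [h, integral_const_mul]
  split_ifs with hni
  · subst hni
    have hp := jacobiSq_pos ha hb n
    have h' : ∫ x in Ioo 0 1, weight a b x * (jacobiG a b n x * jacobiG a b n x) =
        jacobiSq a b n := by simp only [jacobiSq, sq]
    rw [h', Real.mul_self_sqrt hp.le, inv_mul_cancel₀ hp.ne']
  · rw [integral_weight_mul_jacobiG_mul_jacobiG_of_ne ha hb hni, mul_zero]

/-- The factor by which differentiation maps `G̃_{n+1}^{(a,b)}` to `G̃_n^{(a+1,b+1)}`. Its square
is the Sturm–Liouville eigenvalue `j (j + a + b + 1)` for `j = n + 1`. -/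
def ladder (a b : ℝ) (n : ℕ) : ℝ := √((n + 1) * (n + a + b + 2))

theorem sqrt_jacobiSq_succ {a b : ℝ} (ha : -1 < a) (hb : -1 < b) (n : ℕ) :
    (n + 1) * √(jacobiSq a b (n + 1)) = ladder a b n * √(jacobiSq (a + 1) (b + 1) n) := by
  have h2 : (0 : ℝ) < n + a + b + 2 := by
    have : (0 : ℝ) ≤ n := n.cast_nonneg
    linarith
  rw [ladder, ← Real.sqrt_mul (by positivity), mul_assoc, ← jacobiSq_succ ha hb,
    ← mul_assoc, Real.sqrt_mul (by positivity), Real.sqrt_mul_self (by positivity)]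

theorem ladder_pos {a b : ℝ} (ha : -1 < a) (hb : -1 < b) (n : ℕ) : 0 < ladder a b n := by
  have h2 : (0 : ℝ) < n + a + b + 2 := by
    have : (0 : ℝ) ≤ n := n.cast_nonneg
    linarith
  exact Real.sqrt_pos.2 (by positivity)

theorem hasDerivAt_jacobiGNormalized {a b : ℝ} (ha : -1 < a) (hb : -1 < b) (n : ℕ) (x : ℝ) :
    HasDerivAt (jacobiGNormalized a b (n + 1))
      (ladder a b n * jacobiGNormalized (a + 1) (b + 1) n x) x := by
  refine ((hasDerivAt_jacobiG a b n x).div_const _).congr_deriv ?_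
  have h := sqrt_jacobiSq_succ ha hb n
  have p1 := Real.sqrt_pos.2 (jacobiSq_pos ha hb (n + 1))
  have p2 := Real.sqrt_pos.2
    (jacobiSq_pos (a := a + 1) (b := b + 1) (by linarith) (by linarith) n)
  have p3 := ladder_pos ha hb n
  have hsq : ladder a b n ^ 2 = (n + 1) * (n + a + b + 2) := by
    rw [ladder, Real.sq_sqrt]
    have : (0 : ℝ) ≤ n := n.cast_nonneg
    exact mul_nonneg (by positivity) (by linarith)
  rw [jacobiGNormalized_eq, ← mul_div_assoc, ← jacobiSq, div_eq_div_iff p1.ne' p2.ne']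
  have hn : (n + 1 : ℝ) ≠ 0 := by positivity
  apply mul_left_cancel₀ hn
  linear_combination jacobiG (a + 1) (b + 1) n x * (-ladder a b n * h -
    √(jacobiSq (a + 1) (b + 1) n) * hsq)

theorem hasDerivAt_weight_mul_jacobiGNormalized {a b : ℝ} (ha : -1 < a) (hb : -1 < b) (n : ℕ)
    {x : ℝ} (hx : x ∈ Ioo (0 : ℝ) 1) :
    HasDerivAt (fun y => weight (a + 1) (b + 1) y * jacobiGNormalized (a + 1) (b + 1) n y)
      (-ladder a b n * (weight a b x * jacobiGNormalized a b (n + 1) x)) x := by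
  have h0 := (hasDerivAt_weight_mul_jacobiG a b n hx).div_const √(jacobiSq (a + 1) (b + 1) n)
  simp only [mul_div_assoc] at h0
  refine h0.congr_deriv ?_
  have h := sqrt_jacobiSq_succ ha hb n
  have p1 := Real.sqrt_pos.2 (jacobiSq_pos ha hb (n + 1))
  have p2 := Real.sqrt_pos.2
    (jacobiSq_pos (a := a + 1) (b := b + 1) (by linarith) (by linarith) n)
  rw [jacobiGNormalized_eq]
  field_simp
  linear_combination -(weight a b x * jacobiG a b (n + 1) x) * h

/-! ### The orthonormal basis of normalized Jacobi polynomials -/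

theorem integral_weightMeasure (a b : ℝ) (f : ℝ → ℝ) :
    ∫ x, f x ∂(weightMeasure a b) = ∫ x in Ioo 0 1, weight a b x * f x := by
  rw [weightMeasure, integral_withDensity_eq_integral_toReal_smul
    (weight_measurable a b).ennreal_ofReal (by simp)]
  refine setIntegral_congr_fun measurableSet_Ioo fun x hx => ?_
  simp [ENNReal.toReal_ofReal (weight_pos a b hx).le]

theorem integrable_weightMeasure_iff {a b : ℝ} {f : ℝ → ℝ} :
    Integrable f (weightMeasure a b) ↔ IntegrableOn (fun x => weight a b x * f x) (Ioo 0 1) := by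
  rw [weightMeasure, integrable_withDensity_iff_integrable_smul'
    (weight_measurable a b).ennreal_ofReal (by simp)]
  refine integrable_congr ((ae_restrict_mem measurableSet_Ioo).mono fun x hx => ?_)
  simp [ENNReal.toReal_ofReal (weight_pos a b hx).le]

theorem weightMeasure_absolutelyContinuous (a b : ℝ) :
    weightMeasure a b ≪ volume.restrict (Ioo 0 1) :=
  withDensity_absolutelyContinuous _ _

theorem memLp_weightMeasure_of_continuous {a b : ℝ} (ha : -1 < a) (hb : -1 < b) {f : ℝ → ℝ}
    (hf : Continuous f) : MemLp f 2 (weightMeasure a b) := by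
  have := weightMeasure_finite ha hb
  obtain ⟨C, hC⟩ := isCompact_Icc.exists_bound_of_continuousOn (s := Icc (0 : ℝ) 1) hf.continuousOn
  refine MemLp.of_bound hf.aestronglyMeasurable C ?_
  refine (weightMeasure_absolutelyContinuous a b).ae_le ?_
  exact (ae_restrict_mem measurableSet_Ioo).mono fun x hx => hC x (Ioo_subset_Icc_self hx)

/-- The normalized Jacobi polynomial as an element of the weighted `L²` space. -/
def jacobiLp {a b : ℝ} (ha : -1 < a) (hb : -1 < b) (n : ℕ) : WeightedL2 a b :=
  (memLp_weightMeasure_of_continuous ha hb (jacobiGNormalized_continuous a b n)).toLp _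

theorem inner_jacobiLp {a b : ℝ} (ha : -1 < a) (hb : -1 < b) (n : ℕ) (v : WeightedL2 a b) :
    inner ℝ (jacobiLp ha hb n) v = jacobiCoeff a b n v := by
  have h : ∀ᵐ x ∂(weightMeasure a b), inner ℝ (jacobiLp ha hb n x) (v x) =
      v x * jacobiGNormalized a b n x := by
    filter_upwards [(memLp_weightMeasure_of_continuous ha hb
      (jacobiGNormalized_continuous a b n)).coeFn_toLp] with x hx
    rw [jacobiLp, hx]
    simp
  rw [L2.inner_def, integral_congr_ae h, integral_weightMeasure, jacobiCoeff]
  simp only [mul_assoc]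

theorem jacobiCoeff_toLp {a b : ℝ} (j : ℕ) {f : ℝ → ℝ} (hf : MemLp f 2 (weightMeasure a b)) :
    jacobiCoeff a b j (hf.toLp f) = jacobiCoeff a b j f :=
  jacobiCoeff_congr j hf.coeFn_toLp

theorem orthonormal_jacobiLp {a b : ℝ} (ha : -1 < a) (hb : -1 < b) :
    Orthonormal ℝ (jacobiLp ha hb) := by
  rw [orthonormal_iff_ite]
  intro i j
  rw [inner_jacobiLp, jacobiLp, jacobiCoeff_toLp, jacobiCoeff,
    ← integral_weight_mul_jacobiGNormalized ha hb i j]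
  congr 1
  ext x
  ring

theorem integrableOn_weight_mul_Lp {a b : ℝ} (ha : -1 < a) (hb : -1 < b) {v : ℝ → ℝ}
    (hv : MemLp v 2 (weightMeasure a b)) :
    IntegrableOn (fun x => weight a b x * v x) (Ioo 0 1) :=
  have := weightMeasure_finite ha hb
  integrable_weightMeasure_iff.1 (hv.integrable one_le_two)

/-- The Jacobi polynomials span all polynomials. -/
theorem integral_mul_eval_eq_zero {a b : ℝ} (ha : -1 < a) (hb : -1 < b) {w : ℝ → ℝ}
    (hw : IntegrableOn w (Ioo 0 1)) (h : ∀ j, ∫ x in Ioo 0 1, w x * jacobiG a b j x = 0)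
    (p : Polynomial ℝ) : ∫ x in Ioo 0 1, w x * p.eval x = 0 := by
  have hint : ∀ q : Polynomial ℝ, IntegrableOn (fun x => w x * q.eval x) (Ioo 0 1) := fun q =>
    integrableOn_Ioo_mul_continuous hw q.continuous
  have hp : p ∈ Submodule.span ℝ (Set.range (jacobiPoly a b)) := by
    rw [span_jacobiPoly ha hb]; trivial
  induction hp using Submodule.span_induction with
  | mem q hq =>
    obtain ⟨j, rfl⟩ := hq
    simp only [eval_jacobiPoly, h]
  | zero => simp
  | add q r _ _ hq hr =>
    simp only [Polynomial.eval_add, mul_add]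
    rw [integral_add (hint q) (hint r), hq, hr, add_zero]
  | smul c q _ hq =>
    have : ∀ x, w x * (c • q).eval x = c * (w x * q.eval x) := fun x => by
      rw [Polynomial.eval_smul, smul_eq_mul]; ring
    simp only [this, integral_const_mul, hq, mul_zero]

theorem integral_mul_continuous_eq_zero {w : ℝ → ℝ} (hw : IntegrableOn w (Ioo 0 1))
    (h : ∀ p : Polynomial ℝ, ∫ x in Ioo 0 1, w x * p.eval x = 0) {f : ℝ → ℝ}
    (hf : Continuous f) : ∫ x in Ioo 0 1, w x * f x = 0 := by
  have hbound : ∀ ε > 0, |∫ x in Ioo 0 1, w x * f x| ≤ (∫ x in Ioo 0 1, |w x|) * ε := by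
    intro ε hε
    obtain ⟨p, hp⟩ := exists_polynomial_near_of_continuousOn 0 1 f hf.continuousOn ε hε
    have e : ∫ x in Ioo 0 1, w x * f x = ∫ x in Ioo 0 1, w x * (f x - p.eval x) := by
      simp only [mul_sub]
      rw [integral_sub (integrableOn_Ioo_mul_continuous hw hf)
        (integrableOn_Ioo_mul_continuous hw p.continuous), h, sub_zero]
    rw [e, ← integral_mul_const, ← Real.norm_eq_abs]
    refine norm_integral_le_of_norm_le (hw.abs.mul_const ε) ?_
    refine (ae_restrict_mem measurableSet_Ioo).mono fun x hx => ?_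
    rw [norm_mul, Real.norm_eq_abs, Real.norm_eq_abs, abs_sub_comm]
    exact mul_le_mul_of_nonneg_left (hp x (Ioo_subset_Icc_self hx)).le (abs_nonneg _)
  have hlim : Tendsto (fun ε : ℝ => (∫ x in Ioo 0 1, |w x|) * ε) (𝓝[>] 0) (𝓝 0) := by
    have : Tendsto (fun ε : ℝ => (∫ x in Ioo 0 1, |w x|) * ε) (𝓝 0)
      (𝓝 ((∫ x in Ioo 0 1, |w x|) * 0)) := tendsto_id.const_mul _
    rw [mul_zero] at this
    exact this.mono_left nhdsWithin_le_nhds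
  exact abs_nonpos_iff.1 (ge_of_tendsto hlim (eventually_mem_nhdsWithin.mono hbound))

/-- The Jacobi polynomials are complete, since polynomials are uniformly dense in `C[0,1]`. -/
theorem eq_zero_of_jacobiCoeff_eq_zero {a b : ℝ} (ha : -1 < a) (hb : -1 < b) (v : WeightedL2 a b)
    (h : ∀ j, jacobiCoeff a b j v = 0) : v = 0 := by
  have hw := integrableOn_weight_mul_Lp ha hb (Lp.memLp v)
  have h1 : ∀ j, ∫ x in Ioo 0 1, weight a b x * v x * jacobiG a b j x = 0 := by
    intro j
    have hj := h j
    simp only [jacobiCoeff, jacobiGNormalized_eq, ← mul_div_assoc, integral_div] at hj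
    exact (div_eq_zero_iff.1 hj).resolve_right (Real.sqrt_pos.2 (jacobiSq_pos ha hb j)).ne'
  have h2 := isOpen_Ioo.ae_eq_zero_of_integral_contDiff_smul_eq_zero (U := Ioo (0 : ℝ) 1)
    (f := fun x => weight a b x * v x) (μ := volume) hw.locallyIntegrableOn (by
      intro g hg _ hgs
      have h3 := integral_mul_continuous_eq_zero hw (integral_mul_eval_eq_zero ha hb hw h1)
        hg.continuous
      rw [setIntegral_eq_integral_of_forall_compl_eq_zero] at h3
      · simpa only [smul_eq_mul, mul_comm (g _)] using h3
      · intro x hx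
        rw [image_eq_zero_of_notMem_tsupport fun hx' => hx (hgs hx'), mul_zero])
  rw [Lp.eq_zero_iff_ae_eq_zero]
  refine (weightMeasure_absolutelyContinuous a b).ae_le ?_
  refine (ae_restrict_iff' measurableSet_Ioo).2 (h2.mono fun x hx hxI => ?_)
  exact (mul_eq_zero.1 (hx hxI)).resolve_left (weight_pos a b hxI).ne'

/-- The normalized Jacobi polynomials as a Hilbert basis of the weighted `L²` space. -/
def jacobiBasis {a b : ℝ} (ha : -1 < a) (hb : -1 < b) : HilbertBasis ℕ ℝ (WeightedL2 a b) :=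
  HilbertBasis.mkOfOrthogonalEqBot (orthonormal_jacobiLp ha hb) <| by
    refine (Submodule.eq_bot_iff _).2 fun v hv => eq_zero_of_jacobiCoeff_eq_zero ha hb v fun j => ?_
    rw [← inner_jacobiLp ha hb]
    exact (Submodule.mem_orthogonal _ _).1 hv _ (Submodule.subset_span ⟨j, rfl⟩)

theorem jacobiBasis_repr {a b : ℝ} (ha : -1 < a) (hb : -1 < b) (v : WeightedL2 a b) (j : ℕ) :
    (jacobiBasis ha hb).repr v j = jacobiCoeff a b j v := by
  rw [HilbertBasis.repr_apply_apply, jacobiBasis, HilbertBasis.coe_mkOfOrthogonalEqBot,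
    inner_jacobiLp]

theorem hasSum_jacobiCoeff_mul {a b : ℝ} (ha : -1 < a) (hb : -1 < b) (u v : WeightedL2 a b) :
    HasSum (fun j => jacobiCoeff a b j u * jacobiCoeff a b j v) (inner ℝ u v) := by
  have h := (jacobiBasis ha hb).hasSum_inner_mul_inner u v
  refine h.congr_fun fun j => ?_
  rw [real_inner_comm, ← HilbertBasis.repr_apply_apply, ← HilbertBasis.repr_apply_apply,
    jacobiBasis_repr, jacobiBasis_repr]

theorem eLpNorm_sq_eq_tsum {a b : ℝ} (ha : -1 < a) (hb : -1 < b) {f : ℝ → ℝ}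
    (hf : MemLp f 2 (weightMeasure a b)) :
    eLpNorm f 2 (weightMeasure a b) ^ 2 = ∑' j, ENNReal.ofReal (jacobiCoeff a b j f ^ 2) := by
  have h := hasSum_jacobiCoeff_mul ha hb (hf.toLp f) (hf.toLp f)
  simp only [jacobiCoeff_toLp, ← sq] at h
  rw [← ENNReal.ofReal_tsum_of_nonneg (fun j => sq_nonneg _) h.summable, h.tsum_eq,
    real_inner_self_eq_norm_sq, Lp.norm_toLp, ENNReal.ofReal_pow ENNReal.toReal_nonneg,
    ENNReal.ofReal_toReal hf.eLpNorm_ne_top]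

/-- Riesz–Fischer for Jacobi coefficients. -/
theorem exists_of_summable_sq {a b : ℝ} (ha : -1 < a) (hb : -1 < b) {c : ℕ → ℝ}
    (hc : Summable fun j => c j ^ 2) :
    ∃ v : WeightedL2 a b, ∀ j, jacobiCoeff a b j v = c j := by
  have hmem : Memℓp c 2 := by
    rw [memℓp_gen_iff (by norm_num)]
    simpa using hc
  refine ⟨(jacobiBasis ha hb).repr.symm ⟨c, hmem⟩, fun j => ?_⟩
  rw [← jacobiBasis_repr ha hb, LinearIsometryEquiv.apply_symm_apply]

/-! ### Weak derivatives lower the index of Jacobi coefficients -/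

/-- A smooth cutoff on `(0, 1)`: zero where `N x (1 - x) ≤ 1`, one where `N x (1 - x) ≥ 2`. -/
def cutoff (N : ℕ) (x : ℝ) : ℝ := Real.smoothTransition (N * (x * (1 - x)) - 1)

theorem contDiff_cutoff (N : ℕ) {r : ℕ∞} : ContDiff ℝ r (cutoff N) :=
  Real.smoothTransition.contDiff.comp (by fun_prop)

theorem exists_bound_deriv_smoothTransition :
    ∃ M : ℝ, 0 ≤ M ∧ (∀ y, |deriv Real.smoothTransition y| ≤ M) ∧
      (∀ y, 1 < y → deriv Real.smoothTransition y = 0) := by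
  have hc : Continuous (deriv Real.smoothTransition) :=
    (Real.smoothTransition.contDiff (n := 1)).continuous_deriv le_rfl
  obtain ⟨M, hM⟩ := isCompact_Icc.exists_bound_of_continuousOn (s := Icc (0 : ℝ) 1) hc.continuousOn
  have h1 : ∀ y : ℝ, 1 < y → deriv Real.smoothTransition y = 0 := by
    intro y hy
    have : Real.smoothTransition =ᶠ[𝓝 y] fun _ => (1 : ℝ) :=
      (lt_mem_nhds hy).mono fun z hz => Real.smoothTransition.one_of_one_le hz.le
    rw [this.deriv_eq, deriv_const]
  have h0 : ∀ y : ℝ, y < 0 → deriv Real.smoothTransition y = 0 := by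
    intro y hy
    have : Real.smoothTransition =ᶠ[𝓝 y] fun _ => (0 : ℝ) :=
      (gt_mem_nhds hy).mono fun z hz => Real.smoothTransition.zero_of_nonpos hz.le
    rw [this.deriv_eq, deriv_const]
  have hM0 : 0 ≤ M := (norm_nonneg _).trans (hM 0 (by simp))
  refine ⟨M, hM0, fun y => ?_, h1⟩
  rcases lt_or_ge y 0 with hy | hy
  · simpa [h0 y hy]
  rcases lt_or_ge 1 y with hy' | hy'
  · simpa [h1 y hy']
  · exact hM y ⟨hy, hy'⟩

theorem hasDerivAt_cutoff (N : ℕ) (x : ℝ) :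
    HasDerivAt (cutoff N)
      (deriv Real.smoothTransition (N * (x * (1 - x)) - 1) * (N * (1 - 2 * x))) x := by
  have h1 : HasDerivAt (fun x : ℝ => N * (x * (1 - x)) - 1) (N * (1 - 2 * x)) x := by
    have := (((hasDerivAt_id x).mul
      ((hasDerivAt_id x).const_sub 1)).const_mul (N : ℝ)).sub_const 1
    refine this.congr_deriv ?_
    simp only [id]
    ring
  exact (((Real.smoothTransition.contDiff (n := 1)).differentiable one_ne_zero _).hasDerivAt).comp
    x h1

/-- The derivative of the cutoff is at most of the order of the inverse distance to the boundary. -/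
theorem exists_bound_deriv_cutoff :
    ∃ M : ℝ, ∀ (N : ℕ), ∀ x ∈ Ioo (0 : ℝ) 1, |deriv (cutoff N) x| * ((1 - x) * x) ≤ M := by
  obtain ⟨M, hM0, hM, hM1⟩ := exists_bound_deriv_smoothTransition
  refine ⟨2 * M, fun N x hx => ?_⟩
  have hx1 : 0 < (1 - x) * x := mul_pos (by linarith [hx.2]) hx.1
  rw [(hasDerivAt_cutoff N x).deriv]
  rcases lt_or_ge 1 ((N : ℝ) * (x * (1 - x)) - 1) with h | h
  · rw [hM1 _ h]
    simpa
  · have h2 : |1 - 2 * x| ≤ 1 := by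
      rw [abs_le]; constructor <;> linarith [hx.1, hx.2]
    rw [abs_mul, abs_mul, Nat.abs_cast]
    calc |deriv Real.smoothTransition (N * (x * (1 - x)) - 1)| * (N * |1 - 2 * x|) * ((1 - x) * x)
        = |deriv Real.smoothTransition (N * (x * (1 - x)) - 1)| *
            ((N * (x * (1 - x))) * |1 - 2 * x|) := by ring
      _ ≤ M * (2 * 1) := by
          have : 0 ≤ (N : ℝ) * (x * (1 - x)) := by rw [mul_comm x]; positivity
          gcongr
          · exact hM _
          · linarith
      _ = 2 * M := by ring

theorem eventually_le_natCast_mul {x : ℝ} (hx : x ∈ Ioo (0 : ℝ) 1) :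
    ∀ᶠ N : ℕ in atTop, 2 < (N : ℝ) * (x * (1 - x)) := by
  have hx1 : 0 < x * (1 - x) := mul_pos hx.1 (by linarith [hx.2])
  exact (tendsto_natCast_atTop_atTop.atTop_mul_const hx1).eventually_gt_atTop 2

theorem tendsto_cutoff {x : ℝ} (hx : x ∈ Ioo (0 : ℝ) 1) :
    Tendsto (fun N => cutoff N x) atTop (𝓝 1) := by
  refine tendsto_const_nhds.congr' ?_
  filter_upwards [eventually_le_natCast_mul hx] with N hN
  exact (Real.smoothTransition.one_of_one_le (by linarith)).symm

theorem tendsto_deriv_cutoff {x : ℝ} (hx : x ∈ Ioo (0 : ℝ) 1) :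
    Tendsto (fun N => deriv (cutoff N) x) atTop (𝓝 0) := by
  obtain ⟨M, hM0, hM, hM1⟩ := exists_bound_deriv_smoothTransition
  refine tendsto_const_nhds.congr' ?_
  filter_upwards [eventually_le_natCast_mul hx] with N hN
  rw [(hasDerivAt_cutoff N x).deriv, hM1 _ (by linarith), zero_mul]

theorem tsupport_cutoff_mul_subset (N : ℕ) (F : ℝ → ℝ) :
    tsupport (fun x => cutoff N x * F x) ⊆ {x | 1 ≤ (N : ℝ) * (x * (1 - x))} := by
  refine closure_minimal ?_ (isClosed_le continuous_const (by fun_prop))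
  intro x hx
  by_contra h
  simp only [mem_ofPred_eq, not_le] at h
  exact hx (by
    simp only [cutoff]
    rw [Real.smoothTransition.zero_of_nonpos (by linarith), zero_mul])

theorem tsupport_cutoff_mul_subset_Ioo (N : ℕ) (F : ℝ → ℝ) :
    tsupport (fun x => cutoff N x * F x) ⊆ Ioo 0 1 := by
  intro x hx
  have h : (1 : ℝ) ≤ N * (x * (1 - x)) := tsupport_cutoff_mul_subset N F hx
  have hN : (0 : ℝ) ≤ N := N.cast_nonneg
  have h1 : 0 < x * (1 - x) := pos_of_mul_pos_right (by linarith) hN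
  constructor <;> nlinarith

theorem hasCompactSupport_cutoff_mul (N : ℕ) (F : ℝ → ℝ) :
    HasCompactSupport (fun x => cutoff N x * F x) :=
  isCompact_Icc.of_isClosed_subset (isClosed_tsupport _)
    ((tsupport_cutoff_mul_subset_Ioo N F).trans Ioo_subset_Icc_self)

theorem contDiff_cutoff_mul (N : ℕ) {F : ℝ → ℝ} (hF : ∀ x ∈ Ioo (0 : ℝ) 1,
    ContDiffAt ℝ (⊤ : ℕ∞) F x) : ContDiff ℝ (⊤ : ℕ∞) (fun x => cutoff N x * F x) := by
  rw [contDiff_iff_contDiffAt]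
  intro x
  by_cases hx : x ∈ Ioo (0 : ℝ) 1
  · exact (contDiff_cutoff N).contDiffAt.mul (hF x hx)
  · have h := notMem_tsupport_iff_eventuallyEq.1
      fun h => hx (tsupport_cutoff_mul_subset_Ioo N F h)
    exact contDiffAt_const.congr_of_eventuallyEq h

theorem contDiffAt_weight (a b : ℝ) {x : ℝ} (hx : x ∈ Ioo (0 : ℝ) 1) {r : WithTop ℕ∞} :
    ContDiffAt ℝ r (weight a b) x := by
  have h : 1 - x ≠ 0 := by linarith [hx.2]
  exact (ContDiffAt.rpow_const_of_ne (contDiffAt_const.sub contDiffAt_id) h).mul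
    (ContDiffAt.rpow_const_of_ne contDiffAt_id hx.1.ne')

theorem contDiff_jacobiGNormalized (a b : ℝ) (n : ℕ) {r : WithTop ℕ∞} :
    ContDiff ℝ r (jacobiGNormalized a b n) :=
  (contDiff_jacobiG a b n).div_const _

/-- If `g` is the weak derivative of `u`, the Jacobi coefficients of `g` for the parameters
`(a+1, b+1)` are those of `u` for `(a, b)`, shifted and multiplied by the ladder factor.

The weak derivative is tested with `ρ^{(a+1,b+1)} G̃_n^{(a+1,b+1)}` times a cutoff. The derivative
of the cutoff is at most of order `1 / (x (1 - x))`, and `x (1 - x)` is the quotient of the two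
weights, so that dominated convergence removes the cutoff. -/
theorem jacobiCoeff_of_isWeakDeriv_one {a b : ℝ} (ha : -1 < a) (hb : -1 < b) {u g : ℝ → ℝ}
    (hu : MemLp u 2 (weightMeasure a b)) (hg : MemLp g 2 (weightMeasure (a + 1) (b + 1)))
    (h : IsWeakDeriv 1 u g) (n : ℕ) :
    jacobiCoeff (a + 1) (b + 1) n g = ladder a b n * jacobiCoeff a b (n + 1) u := by
  set G := jacobiGNormalized (a + 1) (b + 1) n with hGdef
  set F : ℝ → ℝ := fun y => weight (a + 1) (b + 1) y * G y with hFdef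
  set F' : ℝ → ℝ := fun x => -ladder a b n * (weight a b x * jacobiGNormalized a b (n + 1) x)
    with hF'def
  have hF : ∀ x ∈ Ioo (0 : ℝ) 1, ContDiffAt ℝ (⊤ : ℕ∞) F x := fun x hx =>
    (contDiffAt_weight _ _ hx).mul (contDiff_jacobiGNormalized _ _ _).contDiffAt
  have hF' : ∀ x ∈ Ioo (0 : ℝ) 1, HasDerivAt F (F' x) x := fun x hx =>
    hasDerivAt_weight_mul_jacobiGNormalized ha hb n hx
  have iu := integrableOn_weight_mul_Lp ha hb hu
  have ig := integrableOn_weight_mul_Lp (a := a + 1) (b := b + 1) (by linarith) (by linarith) hg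
  obtain ⟨M, hM⟩ := exists_bound_deriv_cutoff
  obtain ⟨C₁, hC₁⟩ := isCompact_Icc.exists_bound_of_continuousOn (s := Icc (0 : ℝ) 1)
    (jacobiGNormalized_continuous (a + 1) (b + 1) n).continuousOn
  obtain ⟨C₂, hC₂⟩ := isCompact_Icc.exists_bound_of_continuousOn (s := Icc (0 : ℝ) 1)
    (jacobiGNormalized_continuous a b (n + 1)).continuousOn
  have hderiv : ∀ N : ℕ, ∀ x ∈ Ioo (0 : ℝ) 1, deriv (fun x => cutoff N x * F x) x =
      deriv (cutoff N) x * F x + cutoff N x * F' x := fun N x hx =>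
    ((hasDerivAt_cutoff N x).differentiableAt.hasDerivAt.mul (hF' x hx)).deriv
  have hweak : ∀ N : ℕ, ∫ x in Ioo 0 1, u x * (deriv (cutoff N) x * F x + cutoff N x * F' x) =
      -∫ x in Ioo 0 1, g x * (cutoff N x * F x) := by
    intro N
    have := h.2.2 _ (contDiff_cutoff_mul N hF) (hasCompactSupport_cutoff_mul N F)
      (tsupport_cutoff_mul_subset_Ioo N F)
    rw [iteratedDeriv_one, pow_one, neg_one_mul] at this
    rw [← this]
    exact setIntegral_congr_fun measurableSet_Ioo fun x hx => by rw [hderiv N x hx]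
  have hcut : ∀ (N : ℕ) (x : ℝ), |cutoff N x| ≤ 1 := fun N x => by
    rw [cutoff, abs_of_nonneg (Real.smoothTransition.nonneg _)]
    exact Real.smoothTransition.le_one _
  have hR : Tendsto (fun N : ℕ => -∫ x in Ioo 0 1, g x * (cutoff N x * F x)) atTop
      (𝓝 (-∫ x in Ioo 0 1, g x * (1 * F x))) := by
    refine (tendsto_integral_of_dominated_convergence
      (fun x => |weight (a + 1) (b + 1) x * g x| * C₁) (fun N => ?_) (ig.abs.mul_const _)
      (fun N => ?_) ?_).neg
    · exact (h.2.1.aestronglyMeasurable).mul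
        ((contDiff_cutoff_mul N hF).continuous.aestronglyMeasurable)
    · refine (ae_restrict_mem measurableSet_Ioo).mono fun x hx => ?_
      have e : g x * (cutoff N x * F x) =
          cutoff N x * ((weight (a + 1) (b + 1) x * g x) * G x) := by
        rw [hFdef]; ring
      rw [e, norm_mul, norm_mul, Real.norm_eq_abs, Real.norm_eq_abs]
      calc |cutoff N x| * (|weight (a + 1) (b + 1) x * g x| * ‖G x‖)
          ≤ 1 * (|weight (a + 1) (b + 1) x * g x| * C₁) := by
            gcongr
            · exact hcut N x
            · exact hC₁ x (Ioo_subset_Icc_self hx)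
        _ = _ := one_mul _
    · exact (ae_restrict_mem measurableSet_Ioo).mono fun x hx =>
        ((tendsto_cutoff hx).mul_const _).const_mul _
  have hL : Tendsto (fun N : ℕ => ∫ x in Ioo 0 1,
      u x * (deriv (cutoff N) x * F x + cutoff N x * F' x)) atTop
      (𝓝 (∫ x in Ioo 0 1, u x * (0 * F x + 1 * F' x))) := by
    refine tendsto_integral_of_dominated_convergence
      (fun x => |weight a b x * u x| * (M * C₁ + ladder a b n * C₂)) (fun N => ?_)
      (iu.abs.mul_const _) (fun N => ?_) ?_
    · have hc : Continuous (deriv fun x => cutoff N x * F x) :=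
        (contDiff_cutoff_mul N hF).continuous_deriv (by simp)
      refine ((h.1.aestronglyMeasurable).mul (hc.aestronglyMeasurable
        (μ := volume.restrict (Ioo 0 1)))).congr ?_
      exact (ae_restrict_mem measurableSet_Ioo).mono fun x hx => by
        simp only [Pi.mul_apply, hderiv N x hx]
    · refine (ae_restrict_mem measurableSet_Ioo).mono fun x hx => ?_
      have e : u x * (deriv (cutoff N) x * F x + cutoff N x * F' x) =
          (weight a b x * u x) * ((deriv (cutoff N) x * ((1 - x) * x)) * G x -
            cutoff N x * (ladder a b n * jacobiGNormalized a b (n + 1) x)) := by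
        simp only [hFdef, hF'def, weight_add_one a b hx]; ring
      rw [e, norm_mul, Real.norm_eq_abs]
      gcongr
      refine (norm_sub_le _ _).trans (add_le_add ?_ ?_)
      · have hx1 : 0 < (1 - x) * x := mul_pos (by linarith [hx.2]) hx.1
        rw [norm_mul, norm_mul, Real.norm_eq_abs, Real.norm_of_nonneg hx1.le]
        have := hM N x hx
        have h0 : 0 ≤ M := le_trans (by positivity) this
        gcongr
        exact hC₁ x (Ioo_subset_Icc_self hx)
      · rw [norm_mul, norm_mul, Real.norm_eq_abs, Real.norm_of_nonneg (ladder_pos ha hb n).le]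
        have := (ladder_pos ha hb n).le
        calc |cutoff N x| * (ladder a b n * ‖jacobiGNormalized a b (n + 1) x‖)
            ≤ 1 * (ladder a b n * C₂) := by
              gcongr
              · exact hcut N x
              · exact hC₂ x (Ioo_subset_Icc_self hx)
          _ = _ := one_mul _
    · exact (ae_restrict_mem measurableSet_Ioo).mono fun x hx =>
        (((tendsto_deriv_cutoff hx).mul_const _).add ((tendsto_cutoff hx).mul_const _)).const_mul _
  simp only [hweak] at hL
  have heq := tendsto_nhds_unique hL hR
  have e1 : ∫ x in Ioo 0 1, u x * (0 * F x + 1 * F' x) =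
      -(ladder a b n * jacobiCoeff a b (n + 1) u) := by
    rw [jacobiCoeff, ← neg_mul, ← integral_const_mul]
    congr 1
    ext x
    simp only [hF'def]
    ring
  have e2 : ∫ x in Ioo 0 1, g x * (1 * F x) = jacobiCoeff (a + 1) (b + 1) n g := by
    rw [jacobiCoeff]
    congr 1
    ext x
    simp only [hFdef]
    ring
  rw [e1, e2] at heq
  linarith

/-! ### Higher weak derivatives -/

/-- The definition of `IsWeakDeriv (k + 1)` does not mention the derivative of order `k`; if that
exists too, its first weak derivative is the one of order `k + 1`. -/
theorem IsWeakDeriv.of_succ {k : ℕ} {v g h : ℝ → ℝ} (hg : IsWeakDeriv k v g)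
    (hh : IsWeakDeriv (k + 1) v h) : IsWeakDeriv 1 g h := by
  refine ⟨hg.2.1, hh.2.1, fun φ h1 h2 h3 => ?_⟩
  have e1 := hh.2.2 φ h1 h2 h3
  have e2 := hg.2.2 (deriv φ) (contDiff_infty_iff_deriv.1 h1).2 h2.deriv
    ((tsupport_deriv_subset (𝕜 := ℝ)).trans h3)
  rw [iteratedDeriv_succ', e2, pow_succ, mul_assoc] at e1
  rw [iteratedDeriv_one, pow_one]
  exact mul_left_cancel₀ (pow_ne_zero k (by norm_num)) e1

theorem IsWeakDeriv.ae_eq_of_zero {v g : ℝ → ℝ} (h : IsWeakDeriv 0 v g) :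
    g =ᵐ[volume.restrict (Ioo 0 1)] v := by
  have h2 := isOpen_Ioo.ae_eq_zero_of_integral_contDiff_smul_eq_zero (U := Ioo (0 : ℝ) 1)
    (f := g - v) (μ := volume) (h.2.1.sub h.1) (by
      intro φ h1 h2 h3
      have e := h.2.2 φ h1 h2 h3
      simp only [iteratedDeriv_zero, pow_zero, one_mul] at e
      have hi : ∀ f : ℝ → ℝ, LocallyIntegrableOn f (Ioo 0 1) →
          IntegrableOn (fun x => f x * φ x) (Ioo 0 1) := fun f hf =>
        IsWeakDeriv.integrable_mul hf h1.continuous h2 h3 (subset_tsupport φ)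
      have hs : ∫ x in Ioo 0 1, (g x - v x) * φ x = 0 := by
        simp only [sub_mul]
        rw [integral_sub (hi g h.2.1) (hi v h.1), e, sub_self]
      rw [setIntegral_eq_integral_of_forall_compl_eq_zero] at hs
      · simpa only [smul_eq_mul, mul_comm (φ _), Pi.sub_apply] using hs
      · intro x hx
        rw [image_eq_zero_of_notMem_tsupport fun hx' => hx (h3 hx'), mul_zero])
  refine (ae_restrict_iff' measurableSet_Ioo).2 (h2.mono fun x hx hxI => ?_)
  exact sub_eq_zero.1 (hx hxI)

/-- The factor by which the `k`-th derivative maps `G̃_{n+k}^{(a,b)}` to `G̃_n^{(a+k,b+k)}`. -/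
def ladderProd (a b : ℝ) : ℕ → ℕ → ℝ
  | 0, _ => 1
  | k + 1, n => ladder (a + k) (b + k) n * ladderProd a b k (n + 1)

theorem locallyIntegrableOn_of_memLp {a b : ℝ} (ha : -1 < a) (hb : -1 < b) {v : ℝ → ℝ}
    (hv : MemLp v 2 (weightMeasure a b)) : LocallyIntegrableOn v (Ioo 0 1) := by
  have h := (integrableOn_weight_mul_Lp ha hb hv).locallyIntegrableOn
  have hc : ContinuousOn (fun x => (weight a b x)⁻¹) (Ioo 0 1) := fun x hx =>
    (((contDiffAt_weight a b hx (r := 0)).continuousAt).inv₀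
      (weight_pos a b hx).ne').continuousWithinAt
  have h' := h.continuousOn_mul hc isOpen_Ioo.isLocallyClosed
  rw [locallyIntegrableOn_iff isOpen_Ioo.isLocallyClosed] at h' ⊢
  intro K hK hKc
  refine (h' K hK hKc).congr_fun (fun x hx => ?_) hKc.measurableSet
  exact inv_mul_cancel_left₀ (weight_pos a b (hK hx)).ne' (v x)

theorem add_natCast_succ (a : ℝ) (k : ℕ) : a + ((k + 1 : ℕ) : ℝ) = a + k + 1 := by
  push_cast; ring

/-- Coefficients of the `k`-th weak derivative, if all derivatives up to order `k` are square
integrable. -/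
theorem jacobiCoeff_of_isWeakDeriv {a b : ℝ} (ha : -1 < a) (hb : -1 < b) {v : ℝ → ℝ}
    (k : ℕ) (hfin : ∀ i < k, ∃ g, IsWeakDeriv i v g ∧ MemLp g 2 (weightMeasure (a + i) (b + i)))
    {g : ℝ → ℝ} (hg : IsWeakDeriv k v g) (hgL : MemLp g 2 (weightMeasure (a + k) (b + k))) (n : ℕ) :
    jacobiCoeff (a + k) (b + k) n g = ladderProd a b k n * jacobiCoeff a b (n + k) v := by
  induction k generalizing g n with
  | zero =>
    have h := (weightMeasure_absolutelyContinuous a b).ae_le hg.ae_eq_of_zero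
    simp [ladderProd, jacobiCoeff_congr n h]
  | succ k ih =>
    obtain ⟨f, hf, hfL⟩ := hfin k k.lt_succ_self
    have h1 := ih (fun i hi => hfin i (hi.trans k.lt_succ_self)) hf hfL (n + 1)
    have hk : (0 : ℝ) ≤ k := k.cast_nonneg
    rw [add_natCast_succ, add_natCast_succ] at hgL ⊢
    rw [jacobiCoeff_of_isWeakDeriv_one (by linarith) (by linarith) hfL hgL (hf.of_succ hg) n, h1,
      ladderProd, mul_assoc, add_right_comm n 1 k, add_assoc n k 1]

/-! ### Functions with prescribed derivative coefficients -/

theorem integrable_mul_jacobiGNormalized (a b : ℝ) (n : ℕ) {φ : ℝ → ℝ} (hφ : Continuous φ)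
    (hc : HasCompactSupport φ) : Integrable fun x => φ x * jacobiGNormalized a b n x :=
  (hφ.mul (jacobiGNormalized_continuous a b n)).integrable_of_hasCompactSupport hc.mul_right

theorem integral_deriv_mul_jacobiGNormalized_succ {a b : ℝ} (ha : -1 < a) (hb : -1 < b) (n : ℕ)
    {φ : ℝ → ℝ} (hφ : ContDiff ℝ 1 φ) (hc : HasCompactSupport φ) :
    ∫ x, deriv φ x * jacobiGNormalized a b (n + 1) x =
      -(ladder a b n * ∫ x, φ x * jacobiGNormalized (a + 1) (b + 1) n x) := by
  have h := integral_mul_deriv_eq_deriv_mul_of_integrable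
    (u := jacobiGNormalized a b (n + 1))
    (u' := fun x => ladder a b n * jacobiGNormalized (a + 1) (b + 1) n x) (v := φ) (v' := deriv φ)
    (fun x _ => hasDerivAt_jacobiGNormalized ha hb n x)
    (fun x _ => (hφ.differentiable one_ne_zero x).hasDerivAt)
    (by
      have := integrable_mul_jacobiGNormalized a b (n + 1) (hφ.continuous_deriv le_rfl) hc.deriv
      exact this.congr (Eventually.of_forall fun x => mul_comm _ _))
    (by
      have := (integrable_mul_jacobiGNormalized (a + 1) (b + 1) n hφ.continuous hc).const_mul
        (ladder a b n)
      refine this.congr (Eventually.of_forall fun x => ?_)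
      simp only [Pi.mul_apply]
      ring)
    (by
      have := integrable_mul_jacobiGNormalized a b (n + 1) hφ.continuous hc
      exact this.congr (Eventually.of_forall fun x => mul_comm _ _))
  simp only [mul_comm (deriv φ _), mul_comm (φ _)]
  rw [h, ← integral_const_mul]
  simp only [mul_assoc]

theorem integral_deriv_mul_jacobiGNormalized_zero (a b : ℝ)
    {φ : ℝ → ℝ} (hφ : ContDiff ℝ 1 φ) (hc : HasCompactSupport φ) :
    ∫ x, deriv φ x * jacobiGNormalized a b 0 x = 0 := by
  simp only [jacobiGNormalized_eq, jacobiG_zero, integral_mul_const]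
  rw [integral_eq_zero_of_hasDerivAt_of_integrable
    (fun x => (hφ.differentiable one_ne_zero x).hasDerivAt)
    ((hφ.continuous_deriv le_rfl).integrable_of_hasCompactSupport hc.deriv)
    (hφ.continuous.integrable_of_hasCompactSupport hc), zero_mul]

theorem integral_iteratedDeriv_mul_jacobiGNormalized {a b : ℝ} (ha : -1 < a) (hb : -1 < b)
    (k n : ℕ) {φ : ℝ → ℝ} (hφ : ContDiff ℝ (⊤ : ℕ∞) φ) (hc : HasCompactSupport φ) :
    ∫ x, iteratedDeriv k φ x * jacobiGNormalized a b (n + k) x =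
      (-1) ^ k * (ladderProd a b k n * ∫ x, φ x * jacobiGNormalized (a + k) (b + k) n x) := by
  induction k generalizing φ n with
  | zero => simp [ladderProd]
  | succ k ih =>
    have hk : (0 : ℝ) ≤ k := k.cast_nonneg
    have h1 := ih (n + 1) (contDiff_infty_iff_deriv.1 hφ).2 hc.deriv
    rw [integral_deriv_mul_jacobiGNormalized_succ (by linarith) (by linarith) n
      (hφ.of_le (by exact_mod_cast le_top)) hc] at h1
    rw [iteratedDeriv_succ', add_natCast_succ, add_natCast_succ, ladderProd, ← add_assoc,
      add_right_comm, h1]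
    ring

theorem integral_iteratedDeriv_mul_jacobiGNormalized_of_lt {a b : ℝ} (ha : -1 < a) (hb : -1 < b)
    {k j : ℕ} (hj : j < k) {φ : ℝ → ℝ} (hφ : ContDiff ℝ (⊤ : ℕ∞) φ) (hc : HasCompactSupport φ) :
    ∫ x, iteratedDeriv k φ x * jacobiGNormalized a b j x = 0 := by
  induction k generalizing φ with
  | zero => exact absurd hj (Nat.not_lt_zero j)
  | succ k ih =>
    have hφ' := (contDiff_infty_iff_deriv.1 hφ).2
    rw [iteratedDeriv_succ']
    rcases (Nat.lt_succ_iff.1 hj).lt_or_eq with h | rfl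
    · exact ih h hφ' hc.deriv
    · have := integral_iteratedDeriv_mul_jacobiGNormalized ha hb j 0 hφ' hc.deriv
      rw [zero_add, integral_deriv_mul_jacobiGNormalized_zero _ _
        (hφ.of_le (by exact_mod_cast le_top)) hc, mul_zero, mul_zero] at this
      exact this

/-- Parseval's identity for the pairing with `ψ`, viewed as `ψ / ρ` in the weighted space. -/
theorem hasSum_integral_mul {a b : ℝ} (ha : -1 < a) (hb : -1 < b) (v : WeightedL2 a b)
    {ψ : ℝ → ℝ} (hψ : Continuous ψ) (hs : tsupport ψ ⊆ Ioo 0 1) :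
    HasSum (fun j => (∫ x, ψ x * jacobiGNormalized a b j x) * jacobiCoeff a b j v)
      (∫ x in Ioo 0 1, v x * ψ x) := by
  -- `ψ / ρ` is continuous on all of `ℝ`, since `ψ` vanishes near the zeros and poles of `ρ`.
  have hq : Continuous fun x => (weight a b x)⁻¹ * ψ x := by
    rw [continuous_iff_continuousAt]
    intro x
    by_cases hx : x ∈ Ioo (0 : ℝ) 1
    · exact (((contDiffAt_weight a b hx (r := 0)).continuousAt).inv₀
        (weight_pos a b hx).ne').mul hψ.continuousAt
    · have h := notMem_tsupport_iff_eventuallyEq.1 fun h => hx (hs h)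
      refine (continuousAt_const (y := (0 : ℝ))).congr ?_
      filter_upwards [h] with y hy
      simp [hy]
  have hL := memLp_weightMeasure_of_continuous ha hb hq
  have hout : ∀ x, x ∉ Ioo (0 : ℝ) 1 → ψ x = 0 := fun x hx =>
    image_eq_zero_of_notMem_tsupport fun h => hx (hs h)
  have h := hasSum_jacobiCoeff_mul ha hb (hL.toLp _) v
  have e1 : ∀ j, jacobiCoeff a b j (hL.toLp _) = ∫ x, ψ x * jacobiGNormalized a b j x := by
    intro j
    rw [jacobiCoeff_toLp, jacobiCoeff, ← setIntegral_eq_integral_of_forall_compl_eq_zero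
      (s := Ioo (0 : ℝ) 1) (f := fun x => ψ x * jacobiGNormalized a b j x)
      (fun x hx => by rw [hout x hx, zero_mul])]
    refine setIntegral_congr_fun measurableSet_Ioo fun x hx => ?_
    simp only [mul_inv_cancel_left₀ (weight_pos a b hx).ne']
  have e2 : inner ℝ (hL.toLp _) v = ∫ x in Ioo 0 1, v x * ψ x := by
    have h : ∀ᵐ x ∂(weightMeasure a b), inner ℝ (hL.toLp _ x) (v x) =
        v x * ((weight a b x)⁻¹ * ψ x) := by
      filter_upwards [hL.coeFn_toLp] with x hx
      rw [hx]
      simp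
    rw [L2.inner_def, integral_congr_ae h, integral_weightMeasure]
    refine setIntegral_congr_fun measurableSet_Ioo fun x hx => ?_
    have := (weight_pos a b hx).ne'
    field_simp
  simpa only [e1, e2] using h

theorem isWeakDeriv_of_jacobiCoeff {a b : ℝ} (ha : -1 < a) (hb : -1 < b) (k : ℕ)
    (v : WeightedL2 a b) (g : WeightedL2 (a + k) (b + k))
    (h : ∀ n, jacobiCoeff (a + k) (b + k) n g = ladderProd a b k n * jacobiCoeff a b (n + k) v) :
    IsWeakDeriv k v g := by
  have hk : (0 : ℝ) ≤ k := k.cast_nonneg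
  have hak : -1 < a + k := by linarith
  have hbk : -1 < b + k := by linarith
  refine ⟨locallyIntegrableOn_of_memLp ha hb (Lp.memLp v),
    locallyIntegrableOn_of_memLp hak hbk (Lp.memLp g), fun φ h1 h2 h3 => ?_⟩
  have hts : tsupport (iteratedDeriv k φ) ⊆ Ioo 0 1 :=
    (closure_minimal (support_iteratedDeriv_subset k φ) (isClosed_tsupport φ)).trans h3
  have s1 := hasSum_integral_mul ha hb v
    (h1.continuous_iteratedDeriv k (mod_cast le_top)) hts
  have s2 := (hasSum_integral_mul hak hbk g h1.continuous h3).mul_left ((-1) ^ k)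
  rw [← hasSum_nat_add_iff' k, Finset.sum_eq_zero (fun j hj => by
    rw [integral_iteratedDeriv_mul_jacobiGNormalized_of_lt ha hb (Finset.mem_range.1 hj) h1 h2,
      zero_mul]), sub_zero] at s1
  -- Both series are the same after the first `k` terms, which vanish in `s1`, are dropped.
  refine s1.unique ?_
  refine s2.congr_fun fun n => ?_
  rw [integral_iteratedDeriv_mul_jacobiGNormalized ha hb k n h1 h2, h]
  ring

/-! ### The Sobolev norm in terms of Jacobi coefficients -/

/-- The squared norm of the `k`-th derivative of the `j`-th normalized Jacobi polynomial. -/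
def derivEigen (a b : ℝ) (k j : ℕ) : ℝ :=
  ∏ i ∈ Finset.range k, ((j : ℝ) - i) * (j + a + b + 1 + i)

theorem derivEigen_of_lt (a b : ℝ) {k j : ℕ} (h : j < k) : derivEigen a b k j = 0 :=
  Finset.prod_eq_zero (Finset.mem_range.2 h) (by simp)

theorem ladderProd_sq {a b : ℝ} (ha : -1 < a) (hb : -1 < b) (k n : ℕ) :
    ladderProd a b k n ^ 2 = derivEigen a b k (n + k) := by
  induction k generalizing n with
  | zero => simp [ladderProd, derivEigen]
  | succ k ih =>
    have hk : (0 : ℝ) ≤ k := k.cast_nonneg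
    have hn : (0 : ℝ) ≤ n := n.cast_nonneg
    have e : n + (k + 1) = n + 1 + k := by ring
    rw [ladderProd, mul_pow, ih, ladder, Real.sq_sqrt (mul_nonneg (by positivity) (by linarith)),
      derivEigen, derivEigen, Finset.prod_range_succ, e]
    push_cast
    ring

theorem derivEigen_nonneg {a b : ℝ} (ha : -1 < a) (hb : -1 < b) (k j : ℕ) :
    0 ≤ derivEigen a b k j := by
  rcases lt_or_ge j k with h | h
  · rw [derivEigen_of_lt a b h]
  · rw [← Nat.sub_add_cancel h, ← ladderProd_sq ha hb]
    positivity

theorem tsum_derivEigen_eq {a b : ℝ} (ha : -1 < a) (hb : -1 < b) (k : ℕ) (c : ℕ → ℝ) :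
    ∑' j, ENNReal.ofReal (derivEigen a b k j * c j ^ 2) =
      ∑' n, ENNReal.ofReal ((ladderProd a b k n * c (n + k)) ^ 2) := by
  rw [← ENNReal.summable.sum_add_tsum_nat_add' (k := k), Finset.sum_eq_zero (fun j hj => by
    rw [derivEigen_of_lt a b (Finset.mem_range.1 hj), zero_mul, ENNReal.ofReal_zero]), zero_add]
  simp only [mul_pow, ladderProd_sq ha hb]

/-- If the right-hand side is finite, the function in `L²` with weight `ρ^{(a+k,b+k)}` that has the
shifted coefficients is a `k`-th weak derivative of `v`. -/
theorem derivNorm_sq_le {a b : ℝ} (ha : -1 < a) (hb : -1 < b) (k : ℕ) (v : WeightedL2 a b) :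
    derivNorm a b k v ^ 2 ≤
      ∑' j, ENNReal.ofReal (derivEigen a b k j * jacobiCoeff a b j v ^ 2) := by
  have hk : (0 : ℝ) ≤ k := k.cast_nonneg
  have hak : -1 < a + k := by linarith
  have hbk : -1 < b + k := by linarith
  rw [tsum_derivEigen_eq ha hb]
  by_cases htop : ∑' n, ENNReal.ofReal
      ((ladderProd a b k n * jacobiCoeff a b (n + k) v) ^ 2) = ∞
  · rw [htop]
    exact le_top
  have hs := ENNReal.summable_toReal htop
  simp only [ENNReal.toReal_ofReal (sq_nonneg _)] at hs
  obtain ⟨g, hg⟩ := exists_of_summable_sq hak hbk hs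
  have hw := isWeakDeriv_of_jacobiCoeff ha hb k v g hg
  calc derivNorm a b k v ^ 2 ≤ eLpNorm g 2 (weightMeasure (a + k) (b + k)) ^ 2 := by
        gcongr
        exact iInf₂_le _ hw
    _ = _ := by simp only [eLpNorm_sq_eq_tsum hak hbk (Lp.memLp g), hg]

theorem tsum_le_derivNorm_sq {a b : ℝ} (ha : -1 < a) (hb : -1 < b) (k : ℕ) (v : WeightedL2 a b)
    (hfin : ∀ i < k, derivNorm a b i v < ∞) :
    ∑' j, ENNReal.ofReal (derivEigen a b k j * jacobiCoeff a b j v ^ 2) ≤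
      derivNorm a b k v ^ 2 := by
  have hk : (0 : ℝ) ≤ k := k.cast_nonneg
  have hak : -1 < a + k := by linarith
  have hbk : -1 < b + k := by linarith
  have hfin' : ∀ i < k, ∃ g, IsWeakDeriv i v g ∧ MemLp g 2 (weightMeasure (a + i) (b + i)) := by
    intro i hi
    obtain ⟨g, hg⟩ := iInf_lt_iff.1 (hfin i hi)
    obtain ⟨hg1, hg2⟩ := iInf_lt_iff.1 hg
    exact ⟨g, hg1, hg1.aestronglyMeasurable, hg2⟩
  rw [← ENNReal.rpow_le_rpow_iff (z := 1 / 2) (by norm_num)]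
  have e : (derivNorm a b k v ^ 2) ^ (1 / 2 : ℝ) = derivNorm a b k v := by
    rw [← ENNReal.rpow_natCast, ← ENNReal.rpow_mul]
    norm_num
  rw [e]
  refine le_iInf₂ fun g hg => ?_
  by_cases htop : eLpNorm g 2 (weightMeasure (a + k) (b + k)) = ∞
  · rw [htop]
    exact le_top
  have hgL : MemLp g 2 (weightMeasure (a + k) (b + k)) :=
    ⟨hg.aestronglyMeasurable, lt_top_iff_ne_top.2 htop⟩
  have hsum : ∑' j, ENNReal.ofReal (derivEigen a b k j * jacobiCoeff a b j v ^ 2) =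
      eLpNorm g 2 (weightMeasure (a + k) (b + k)) ^ 2 := by
    rw [tsum_derivEigen_eq ha hb, eLpNorm_sq_eq_tsum hak hbk hgL]
    simp only [jacobiCoeff_of_isWeakDeriv ha hb k hfin' hg hgL]
  rw [hsum, ← ENNReal.rpow_natCast, ← ENNReal.rpow_mul]
  norm_num

/-- The squared Sobolev norm of order `n` of the `j`-th normalized Jacobi polynomial. -/
def sobolevEigen (a b : ℝ) (n j : ℕ) : ℝ := ∑ k ∈ Finset.range (n + 1), derivEigen a b k j

/-- The Sobolev norm is a weighted `ℓ²` norm of the Jacobi coefficients, including the case that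
both are infinite. -/
theorem sobolevNorm_eq {a b : ℝ} (ha : -1 < a) (hb : -1 < b) (n : ℕ) (v : WeightedL2 a b) :
    sobolevNorm a b n v =
      (∑' j, ENNReal.ofReal (sobolevEigen a b n j * jacobiCoeff a b j v ^ 2)) ^ (1 / 2 : ℝ) := by
  have hsum : ∑' j, ENNReal.ofReal (sobolevEigen a b n j * jacobiCoeff a b j v ^ 2) =
      ∑ k ∈ Finset.range (n + 1),
        ∑' j, ENNReal.ofReal (derivEigen a b k j * jacobiCoeff a b j v ^ 2) := by
    rw [← Summable.tsum_finsetSum fun _ _ => ENNReal.summable]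
    refine tsum_congr fun j => ?_
    rw [sobolevEigen, Finset.sum_mul, ENNReal.ofReal_sum_of_nonneg]
    exact fun k _ => mul_nonneg (derivEigen_nonneg ha hb k j) (sq_nonneg _)
  change (∑ k ∈ Finset.range (n + 1), derivNorm a b k v ^ 2) ^ (1 / 2 : ℝ) = _
  congr 1
  rw [hsum]
  refine le_antisymm (Finset.sum_le_sum fun k _ => derivNorm_sq_le ha hb k v) ?_
  by_cases hfin : ∀ i ∈ Finset.range (n + 1), derivNorm a b i v < ∞
  · refine Finset.sum_le_sum fun k hk => tsum_le_derivNorm_sq ha hb k v fun i hi => hfin i ?_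
    exact Finset.mem_range.2 (hi.trans (Finset.mem_range.1 hk))
  · push Not at hfin
    obtain ⟨i, hi, hi'⟩ := hfin
    have : ∑ k ∈ Finset.range (n + 1), derivNorm a b k v ^ 2 = ∞ :=
      ENNReal.sum_eq_top.2 ⟨i, hi, by simp [top_le_iff.1 hi']⟩
    rw [this]
    exact le_top

theorem derivEigen_le {a b : ℝ} (ha : -1 < a) (hb : -1 < b) {k n : ℕ} (hkn : k ≤ n) (j : ℕ) :
    derivEigen a b k j ≤ (1 + |a + b + 1| + n) ^ n * (1 + (j : ℝ) ^ 2) ^ n := by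
  have hD : 1 ≤ 1 + |a + b + 1| + n := by
    have := abs_nonneg (a + b + 1)
    have : (0 : ℝ) ≤ n := n.cast_nonneg
    linarith
  have hB : 1 ≤ (1 + |a + b + 1| + n) * (1 + (j : ℝ) ^ 2) :=
    one_le_mul_of_one_le_of_one_le hD (by nlinarith)
  rw [← mul_pow]
  refine le_trans ?_ (pow_le_pow_right₀ hB hkn)
  rcases lt_or_ge j k with h | h
  · rw [derivEigen_of_lt a b h]
    positivity
  rw [derivEigen]
  refine (Finset.prod_le_prod (g := fun _ => (1 + |a + b + 1| + n) * (1 + (j : ℝ) ^ 2))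
    (fun i hi => ?_) (fun i hi => ?_)).trans (by simp)
  all_goals
    have hi' : (i : ℝ) + 1 ≤ j := by exact_mod_cast (Finset.mem_range.1 hi).trans_le h
    have hin : (i : ℝ) ≤ n := by exact_mod_cast ((Finset.mem_range.1 hi).trans_le hkn).le
    have hi0 : (0 : ℝ) ≤ i := i.cast_nonneg
  · exact mul_nonneg (by linarith) (by linarith)
  · have h1 := le_abs_self (a + b + 1)
    calc ((j : ℝ) - i) * (j + a + b + 1 + i) ≤ j * (j + (|a + b + 1| + n)) := by
          gcongr ?_ * ?_ <;> linarith
      _ ≤ (1 + |a + b + 1| + n) * (1 + (j : ℝ) ^ 2) := by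
          have h2 : 0 ≤ |a + b + 1| + n := by linarith
          nlinarith [sq_nonneg ((j : ℝ) - 1), mul_nonneg h2 (sq_nonneg ((j : ℝ) - 1)),
            mul_nonneg h2 (sq_nonneg (j : ℝ))]

theorem le_derivEigen {a b : ℝ} (ha : -1 < a) (hb : -1 < b) {n j : ℕ} (hj : n ≤ j) (hj1 : 1 ≤ j) :
    (min 1 (a + b + 2) / (2 * (n + 1))) ^ n * (1 + (j : ℝ) ^ 2) ^ n ≤ derivEigen a b n j := by
  set δ := min 1 (a + b + 2) with hδ
  have hδ0 : 0 < δ := lt_min one_pos (by linarith)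
  have hδ1 : δ ≤ 1 := min_le_left _ _
  have hδ2 : δ ≤ a + b + 2 := min_le_right _ _
  have hj1' : (1 : ℝ) ≤ j := by exact_mod_cast hj1
  have hjn : (n : ℝ) ≤ j := by exact_mod_cast hj
  have hn0 : (0 : ℝ) ≤ n := n.cast_nonneg
  rw [← mul_pow]
  have e : (δ / (2 * (n + 1)) * (1 + (j : ℝ) ^ 2)) ^ n =
      ∏ _i ∈ Finset.range n, δ / (2 * (n + 1)) * (1 + (j : ℝ) ^ 2) := by simp
  rw [e, derivEigen]
  refine Finset.prod_le_prod (fun i _ => by positivity) fun i hi => ?_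
  have hi' : (i : ℝ) + 1 ≤ n := by exact_mod_cast Finset.mem_range.1 hi
  have hi0 : (0 : ℝ) ≤ i := i.cast_nonneg
  -- `i ≤ n - 1` and `n ≤ j` keep `j - i` away from zero in proportion to `j`, and `a + b + 2 > 0`
  -- does the same for the other factor.
  have h1 : (j : ℝ) / (n + 1) ≤ j - i := by
    rw [div_le_iff₀ (by positivity)]
    nlinarith
  have h2 : δ * j ≤ j + a + b + 1 + i := by nlinarith
  calc δ / (2 * (n + 1)) * (1 + (j : ℝ) ^ 2) ≤ δ / (2 * (n + 1)) * (2 * (j : ℝ) ^ 2) := by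
        gcongr
        nlinarith
    _ = (j : ℝ) / (n + 1) * (δ * j) := by field_simp
    _ ≤ _ := mul_le_mul h1 h2 (by positivity) (by linarith)

theorem exists_sobolevEigen_equiv {a b : ℝ} (ha : -1 < a) (hb : -1 < b) (n : ℕ) :
    ∃ c C : ℝ, 0 < c ∧ 0 < C ∧ ∀ j : ℕ, c * (1 + (j : ℝ) ^ 2) ^ n ≤ sobolevEigen a b n j ∧
      sobolevEigen a b n j ≤ C * (1 + (j : ℝ) ^ 2) ^ n := by
  have hδ0 : 0 < min 1 (a + b + 2) := lt_min one_pos (by linarith)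
  -- For `j ≥ n` the top order term alone dominates `(1 + j²)^n`; for the finitely many smaller `j`
  -- the zeroth order term is `1` and `(1 + j²)^n ≤ (1 + n²)^n`.
  refine ⟨min (1 / (1 + (n : ℝ) ^ 2) ^ n) ((min 1 (a + b + 2) / (2 * (n + 1))) ^ n),
    (n + 1) * (1 + |a + b + 1| + n) ^ n, lt_min (by positivity) (by positivity), by positivity,
    fun j => ⟨?_, ?_⟩⟩
  · have hle : ∀ k ∈ Finset.range (n + 1), derivEigen a b k j ≤ sobolevEigen a b n j := fun k hk =>
      Finset.single_le_sum (f := fun k => derivEigen a b k j)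
        (fun i _ => derivEigen_nonneg ha hb i j) hk
    by_cases h : n ≤ j ∧ 1 ≤ j
    · refine le_trans ?_ ((le_derivEigen ha hb h.1 h.2).trans (hle n (by simp)))
      gcongr
      exact min_le_right _ _
    · have hjn : j ≤ n := by omega
      refine le_trans ?_ (hle 0 (by simp))
      calc _ ≤ 1 / (1 + (n : ℝ) ^ 2) ^ n * (1 + (n : ℝ) ^ 2) ^ n := by
            gcongr
            exact min_le_left _ _
        _ = 1 := by field_simp
        _ = derivEigen a b 0 j := by simp [derivEigen]
  · refine (Finset.sum_le_sum fun k hk => derivEigen_le ha hb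
      (Nat.lt_succ_iff.1 (Finset.mem_range.1 hk)) j).trans ?_
    simp [mul_assoc]

/-! ### Interpolation of weighted `ℓ²` norms -/

/-- The squared norm of the coefficient sequence `c` in `ℓ²` with weight `w`. -/
def diagSq (w c : ℕ → ℝ) : ℝ≥0∞ := ∑' j, ENNReal.ofReal (w j * c j ^ 2)

theorem diagSq_mono {w w' : ℕ → ℝ} (h : ∀ j, w j ≤ w' j) (c : ℕ → ℝ) :
    diagSq w c ≤ diagSq w' c :=
  ENNReal.tsum_le_tsum fun j => ENNReal.ofReal_le_ofReal
    (mul_le_mul_of_nonneg_right (h j) (sq_nonneg _))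

theorem diagSq_const_mul {K : ℝ} (hK : 0 ≤ K) (w c : ℕ → ℝ) :
    diagSq (fun j => K * w j) c = ENNReal.ofReal K * diagSq w c := by
  simp only [diagSq, mul_assoc, ENNReal.ofReal_mul hK, ENNReal.tsum_mul_left]

theorem rpow_half_sq (x : ℝ≥0∞) : (x ^ (1 / 2 : ℝ)) ^ 2 = x := by
  rw [← ENNReal.rpow_natCast, ← ENNReal.rpow_mul]
  norm_num

theorem sq_rpow_half (x : ℝ≥0∞) : (x ^ 2) ^ (1 / 2 : ℝ) = x := by
  rw [← ENNReal.rpow_natCast, ← ENNReal.rpow_mul]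
  norm_num

/-- `K(t, u)²` is at least half of the squared `ℓ²` norm with weight `min(w₀, t² w₁)`. -/
theorem le_kFunctional_sq {E : Type*} [AddCommGroup E] [Module ℝ E] {N₀ N₁ : ExtSeminorm E}
    {w₀ w₁ : ℕ → ℝ} {coef : E → ℕ → ℝ} (hsub : ∀ u v j, coef (u - v) j = coef u j - coef v j)
    (h₀ : ∀ j, 0 < w₀ j) (h₁ : ∀ j, 0 < w₁ j)
    (hN₀ : ∀ v, N₀ v = diagSq w₀ (coef v) ^ (1 / 2 : ℝ))
    (hN₁ : ∀ v, N₁ v = diagSq w₁ (coef v) ^ (1 / 2 : ℝ)) {t : ℝ} (ht : 0 < t) (u : E) :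
    ENNReal.ofReal (1 / 2) * diagSq (fun j => min (w₀ j) (t ^ 2 * w₁ j)) (coef u) ≤
      ExtSeminorm.kFunctional N₀ N₁ t u ^ 2 := by
  rw [← ENNReal.rpow_le_rpow_iff (z := 1 / 2) (by norm_num), sq_rpow_half]
  refine le_iInf₂ fun v _ => ?_
  rw [← ENNReal.rpow_le_rpow_iff (z := 2) (by norm_num), ← ENNReal.rpow_mul]
  norm_num only
  rw [ENNReal.rpow_one, ENNReal.rpow_two, add_sq]
  have hle : ENNReal.ofReal (1 / 2) * diagSq (fun j => min (w₀ j) (t ^ 2 * w₁ j)) (coef u) ≤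
      N₀ (u - v) ^ 2 + (ENNReal.ofReal t * N₁ v) ^ 2 := by
    rw [mul_pow, hN₀, hN₁, rpow_half_sq, rpow_half_sq, ← ENNReal.ofReal_pow ht.le,
      ← diagSq_const_mul (sq_nonneg t), ← diagSq_const_mul (by norm_num), diagSq, diagSq, diagSq,
      ← ENNReal.tsum_add]
    refine ENNReal.tsum_le_tsum fun j => ?_
    have p0 := h₀ j
    have p1 := h₁ j
    rw [← ENNReal.ofReal_add (by positivity) (by positivity), hsub]
    refine ENNReal.ofReal_le_ofReal ?_
    set m := min (w₀ j) (t ^ 2 * w₁ j) with hm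
    have hm0 : 0 ≤ m := le_min p0.le (by positivity)
    set x := coef u j
    set y := coef v j
    calc 1 / 2 * m * x ^ 2 ≤ m * (x - y) ^ 2 + m * y ^ 2 := by
          nlinarith [mul_nonneg hm0 (sq_nonneg (x - 2 * y))]
      _ ≤ _ := by
          gcongr
          · exact min_le_left _ _
          · exact min_le_right _ _
  refine hle.trans ?_
  gcongr
  exact le_self_add

/-- `K(t, u)²` is at most four times the squared `ℓ²` norm with weight `min(w₀, t² w₁)`: in the
decomposition of `u`, the coefficients with `t² w₁ ≤ w₀` are put into the second space. -/
theorem kFunctional_sq_le {E : Type*} [AddCommGroup E] [Module ℝ E] {N₀ N₁ : ExtSeminorm E}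
    {w₀ w₁ : ℕ → ℝ} {coef : E → ℕ → ℝ} (hsub : ∀ u v j, coef (u - v) j = coef u j - coef v j)
    (htrunc : ∀ (u : E) (S : Set ℕ), ∃ v, ∀ j, coef v j = S.indicator (coef u) j)
    (h₀ : ∀ j, 0 < w₀ j) (h₁ : ∀ j, 0 < w₁ j)
    (hN₀ : ∀ v, N₀ v = diagSq w₀ (coef v) ^ (1 / 2 : ℝ))
    (hN₁ : ∀ v, N₁ v = diagSq w₁ (coef v) ^ (1 / 2 : ℝ)) {t : ℝ} (ht : 0 < t) (u : E) :
    ExtSeminorm.kFunctional N₀ N₁ t u ^ 2 ≤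
      4 * diagSq (fun j => min (w₀ j) (t ^ 2 * w₁ j)) (coef u) := by
  set D := diagSq (fun j => min (w₀ j) (t ^ 2 * w₁ j)) (coef u) with hD
  by_cases htop : D = ∞
  · rw [htop, ENNReal.mul_top (by norm_num)]
    exact le_top
  -- Finiteness of `D` also makes the truncated vector an element of the second space.
  obtain ⟨v, hv⟩ := htrunc u {j | t ^ 2 * w₁ j ≤ w₀ j}
  have e0 : N₀ (u - v) ≤ D ^ (1 / 2 : ℝ) := by
    rw [hN₀]
    refine ENNReal.rpow_le_rpow (ENNReal.tsum_le_tsum fun j => ENNReal.ofReal_le_ofReal ?_)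
      (by norm_num)
    simp only [hsub, hv]
    have p0 := h₀ j
    have p1 := h₁ j
    by_cases hj : t ^ 2 * w₁ j ≤ w₀ j
    · rw [indicator_of_mem (by exact hj), min_eq_right hj, sub_self]
      have : 0 ≤ t ^ 2 * w₁ j * coef u j ^ 2 := by positivity
      simpa using this
    · rw [indicator_of_notMem (by exact hj), min_eq_left (le_of_not_ge hj), sub_zero]
  have e1 : ENNReal.ofReal t * N₁ v ≤ D ^ (1 / 2 : ℝ) := by
    rw [hN₁, ← sq_mul_rpow_half, ← ENNReal.ofReal_pow ht.le, ← diagSq_const_mul (by positivity)]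
    refine ENNReal.rpow_le_rpow (ENNReal.tsum_le_tsum fun j => ENNReal.ofReal_le_ofReal ?_)
      (by norm_num)
    simp only [hv]
    have p0 := h₀ j
    by_cases hj : t ^ 2 * w₁ j ≤ w₀ j
    · rw [indicator_of_mem (by exact hj), min_eq_right hj]
    · rw [indicator_of_notMem (by exact hj), min_eq_left (le_of_not_ge hj)]
      have : 0 ≤ w₀ j * coef u j ^ 2 := by positivity
      simpa using this
  have hDtop : D ^ (1 / 2 : ℝ) < ∞ := ENNReal.rpow_lt_top_of_nonneg (by norm_num) htop
  have hmem : v ∈ N₁.space := by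
    have h := e1.trans_lt hDtop
    exact ENNReal.lt_top_of_mul_ne_top_right h.ne (by simpa using ht)
  have hK : ExtSeminorm.kFunctional N₀ N₁ t u ≤ 2 * D ^ (1 / 2 : ℝ) :=
    (iInf₂_le v hmem).trans ((add_le_add e0 e1).trans (two_mul _).ge)
  calc ExtSeminorm.kFunctional N₀ N₁ t u ^ 2 ≤ (2 * D ^ (1 / 2 : ℝ)) ^ 2 := by gcongr
    _ = 4 * D := by rw [mul_pow, rpow_half_sq]; norm_num

/-- The value of `∫_0^∞ t^(-2θ) min(1, t²) dt/t`. -/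
def interpConst (θ : ℝ) : ℝ := 1 / (2 - 2 * θ) + 1 / (2 * θ)

theorem interpConst_pos {θ : ℝ} (h0 : 0 < θ) (h1 : θ < 1) : 0 < interpConst θ := by
  have : 0 < 2 - 2 * θ := by linarith
  unfold interpConst
  positivity

theorem lintegral_rpow_mul_min {θ p q : ℝ} (h0 : 0 < θ) (h1 : θ < 1) (hp : 0 < p) (hq : 0 < q) :
    ∫⁻ t in Ioi (0 : ℝ), ENNReal.ofReal (t ^ (-2 * θ) / t * min p (t ^ 2 * q)) =
      ENNReal.ofReal (interpConst θ * (p ^ (1 - θ) * q ^ θ)) := by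
  set T := (p / q) ^ (1 / 2 : ℝ) with hT
  have hpq : 0 < p / q := div_pos hp hq
  have hT0 : 0 < T := Real.rpow_pos_of_pos hpq _
  have hT2 : T ^ 2 = p / q := by
    rw [hT, ← Real.rpow_natCast, ← Real.rpow_mul hpq.le]
    norm_num
  -- The minimum switches from `t² q` to `p` at `t = T`.
  have hsplit : Ioi (0 : ℝ) = Ioc 0 T ∪ Ioi T := (Ioc_union_Ioi_eq_Ioi hT0.le).symm
  rw [hsplit, lintegral_union measurableSet_Ioi (Ioc_disjoint_Ioi le_rfl)]
  have hlow : ∫⁻ t in Ioc 0 T, ENNReal.ofReal (t ^ (-2 * θ) / t * min p (t ^ 2 * q)) =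
      ENNReal.ofReal (1 / (2 - 2 * θ) * (p ^ (1 - θ) * q ^ θ)) := by
    have e : ∫⁻ t in Ioc 0 T, ENNReal.ofReal (t ^ (-2 * θ) / t * min p (t ^ 2 * q)) =
        ∫⁻ t in Ioc 0 T, ENNReal.ofReal (t ^ (1 - 2 * θ) * q) := by
      refine setLIntegral_congr_fun measurableSet_Ioc fun t ht => ?_
      have ht0 : 0 < t := ht.1
      have hmin : t ^ 2 * q ≤ p := by
        rw [← le_div_iff₀ hq, ← hT2]
        exact pow_le_pow_left₀ ht0.le ht.2 2
      have e1 : t ^ (1 - 2 * θ) = t * t ^ (-2 * θ) := by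
        rw [sub_eq_add_neg, Real.rpow_add ht0, Real.rpow_one, neg_mul]
      simp only [min_eq_right hmin, e1]
      congr 1
      field_simp
    have hi : IntervalIntegrable (fun t : ℝ => t ^ (1 - 2 * θ) * q) volume 0 T :=
      (intervalIntegral.intervalIntegrable_rpow' (by linarith)).mul_const q
    rw [e, ← ofReal_integral_eq_lintegral_ofReal
      ((intervalIntegrable_iff_integrableOn_Ioc_of_le hT0.le).1 hi)
      ((ae_restrict_mem measurableSet_Ioc).mono fun t ht =>
        mul_nonneg (Real.rpow_nonneg ht.1.le _) hq.le), ← intervalIntegral.integral_of_le hT0.le,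
      intervalIntegral.integral_mul_const, integral_rpow (Or.inl (by linarith))]
    congr 1
    have e2 : T ^ (1 - 2 * θ + 1) = (p / q) ^ (1 - θ) := by
      rw [hT, ← Real.rpow_mul hpq.le]
      congr 1
      ring
    have e3 : (p / q) ^ (1 - θ) * q = p ^ (1 - θ) * q ^ θ := by
      rw [Real.div_rpow hp.le hq.le, Real.rpow_sub hq, Real.rpow_one]
      have := Real.rpow_pos_of_pos hq θ
      field_simp
    rw [e2, Real.zero_rpow (by linarith), sub_zero, ← e3]
    have : 2 - 2 * θ ≠ 0 := by linarith
    have h' : 1 - 2 * θ + 1 = 2 - 2 * θ := by ring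
    rw [h']
    field_simp
  have hhigh : ∫⁻ t in Ioi T, ENNReal.ofReal (t ^ (-2 * θ) / t * min p (t ^ 2 * q)) =
      ENNReal.ofReal (1 / (2 * θ) * (p ^ (1 - θ) * q ^ θ)) := by
    have e : ∫⁻ t in Ioi T, ENNReal.ofReal (t ^ (-2 * θ) / t * min p (t ^ 2 * q)) =
        ∫⁻ t in Ioi T, ENNReal.ofReal (t ^ (-2 * θ - 1) * p) := by
      refine setLIntegral_congr_fun measurableSet_Ioi fun t ht => ?_
      have ht0 : 0 < t := hT0.trans ht
      have hmin : p ≤ t ^ 2 * q := by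
        rw [← div_le_iff₀ hq, ← hT2]
        exact pow_le_pow_left₀ hT0.le (le_of_lt ht) 2
      simp only [min_eq_left hmin, Real.rpow_sub_one ht0.ne']
    have hi : IntegrableOn (fun t : ℝ => t ^ (-2 * θ - 1) * p) (Ioi T) :=
      (integrableOn_Ioi_rpow_of_lt (by linarith) hT0).mul_const p
    rw [e, ← ofReal_integral_eq_lintegral_ofReal hi
      ((ae_restrict_mem measurableSet_Ioi).mono fun t ht =>
        mul_nonneg (Real.rpow_nonneg (hT0.le.trans (le_of_lt ht)) _) hp.le), integral_mul_const,
      integral_Ioi_rpow_of_lt (by linarith) hT0]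
    congr 1
    have e2 : T ^ (-2 * θ - 1 + 1) = (p / q) ^ (-θ) := by
      rw [hT, ← Real.rpow_mul hpq.le]
      congr 1
      ring
    have e3 : (p / q) ^ (-θ) * p = p ^ (1 - θ) * q ^ θ := by
      rw [Real.rpow_neg hpq.le, Real.div_rpow hp.le hq.le, Real.rpow_sub hp, Real.rpow_one]
      have := Real.rpow_pos_of_pos hq θ
      field_simp
    rw [e2, ← e3]
    have h' : -2 * θ - 1 + 1 = -(2 * θ) := by ring
    rw [h']
    field_simp
  have hA : 0 ≤ p ^ (1 - θ) * q ^ θ := by positivity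
  rw [hlow, hhigh, ← ENNReal.ofReal_add (mul_nonneg (by
    have : 0 < 2 - 2 * θ := by linarith
    positivity) hA) (by positivity), interpConst, add_mul]

theorem lintegral_mul_diagSq_min {θ : ℝ} (h0 : 0 < θ) (h1 : θ < 1) {w₀ w₁ : ℕ → ℝ}
    (hw₀ : ∀ j, 0 < w₀ j) (hw₁ : ∀ j, 0 < w₁ j) (c : ℕ → ℝ) :
    ∫⁻ t in Ioi (0 : ℝ), ENNReal.ofReal (t ^ (-2 * θ) / t) *
        diagSq (fun j => min (w₀ j) (t ^ 2 * w₁ j)) c =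
      ENNReal.ofReal (interpConst θ) * diagSq (fun j => w₀ j ^ (1 - θ) * w₁ j ^ θ) c := by
  rw [← diagSq_const_mul (interpConst_pos h0 h1).le]
  have e : ∀ t ∈ Ioi (0 : ℝ), ENNReal.ofReal (t ^ (-2 * θ) / t) *
      diagSq (fun j => min (w₀ j) (t ^ 2 * w₁ j)) c = ∑' j, ENNReal.ofReal (c j ^ 2) *
        ENNReal.ofReal (t ^ (-2 * θ) / t * min (w₀ j) (t ^ 2 * w₁ j)) := by
    intro t ht
    have ht0 : (0 : ℝ) < t := ht
    rw [diagSq, ← ENNReal.tsum_mul_left]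
    refine tsum_congr fun j => ?_
    rw [← ENNReal.ofReal_mul (by positivity), ← ENNReal.ofReal_mul (sq_nonneg _)]
    congr 1
    ring
  rw [setLIntegral_congr_fun measurableSet_Ioi e, lintegral_tsum fun j => by fun_prop, diagSq]
  refine tsum_congr fun j => ?_
  rw [lintegral_const_mul _ (by fun_prop), lintegral_rpow_mul_min h0 h1 (hw₀ j) (hw₁ j),
    ← ENNReal.ofReal_mul (sq_nonneg _)]
  congr 1
  ring

/-- Interpolating two weighted `ℓ²` norms gives, up to constants, the `ℓ²` norm with weight
`w₀^(1-θ) w₁^θ`. -/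
theorem interpolation_diag_equiv {E : Type*} [AddCommGroup E] [Module ℝ E]
    {N₀ N₁ : ExtSeminorm E} {w₀ w₁ : ℕ → ℝ} {coef : E → ℕ → ℝ}
    (hsub : ∀ u v j, coef (u - v) j = coef u j - coef v j)
    (htrunc : ∀ (u : E) (S : Set ℕ), ∃ v, ∀ j, coef v j = S.indicator (coef u) j)
    (h₀ : ∀ j, 0 < w₀ j) (h₁ : ∀ j, 0 < w₁ j)
    (hN₀ : ∀ v, N₀ v = diagSq w₀ (coef v) ^ (1 / 2 : ℝ))
    (hN₁ : ∀ v, N₁ v = diagSq w₁ (coef v) ^ (1 / 2 : ℝ)) {θ : ℝ} (hθ0 : 0 < θ) (hθ1 : θ < 1)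
    (u : E) :
    ENNReal.ofReal (1 / 2 * interpConst θ) *
        diagSq (fun j => w₀ j ^ (1 - θ) * w₁ j ^ θ) (coef u) ≤ N₀.interpolation N₁ θ u ^ 2 ∧
      N₀.interpolation N₁ θ u ^ 2 ≤ ENNReal.ofReal (4 * interpConst θ) *
        diagSq (fun j => w₀ j ^ (1 - θ) * w₁ j ^ θ) (coef u) := by
  have hdef : N₀.interpolation N₁ θ u ^ 2 = ∫⁻ t in Ioi (0 : ℝ),
      ENNReal.ofReal (t ^ (-2 * θ) / t) * ExtSeminorm.kFunctional N₀ N₁ t u ^ 2 := by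
    exact rpow_half_sq _
  have hcst : ∀ K : ℝ, 0 ≤ K → ENNReal.ofReal (K * interpConst θ) *
      diagSq (fun j => w₀ j ^ (1 - θ) * w₁ j ^ θ) (coef u) =
      ∫⁻ t in Ioi (0 : ℝ), ENNReal.ofReal (t ^ (-2 * θ) / t) *
        (ENNReal.ofReal K * diagSq (fun j => min (w₀ j) (t ^ 2 * w₁ j)) (coef u)) := by
    intro K hK
    rw [ENNReal.ofReal_mul hK, mul_assoc, ← lintegral_mul_diagSq_min hθ0 hθ1 h₀ h₁,
      ← lintegral_const_mul' _ _ ENNReal.ofReal_ne_top]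
    simp only [mul_left_comm]
  rw [hdef, hcst _ (by norm_num), hcst _ (by norm_num)]
  constructor
  · refine setLIntegral_mono' measurableSet_Ioi fun t ht => ?_
    gcongr
    exact le_kFunctional_sq hsub h₀ h₁ hN₀ hN₁ ht u
  · refine setLIntegral_mono' measurableSet_Ioi fun t ht => ?_
    gcongr
    simpa using kFunctional_sq_le hsub htrunc h₀ h₁ hN₀ hN₁ ht u

/-! ### Equivalent norms and their dual norms -/

namespace ExtSeminorm

variable {E : Type*} [AddCommGroup E] [Module ℝ E] {N₁ N₂ : ExtSeminorm E}

theorem space_le_of_le {C : ℝ≥0} (h : ∀ v, N₂ v ≤ C * N₁ v) : N₁.space ≤ N₂.space :=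
  fun v hv => (h v).trans_lt (ENNReal.mul_lt_top ENNReal.coe_lt_top hv)

/-- The vectors with `N₂ g = 0` need no separate argument: then `N₁ g = 0` too, and in `ℝ≥0∞` the
quotients `‖F g‖ / N₁ g` and `‖F g‖ / N₂ g` agree. -/
theorem dualNorm_le_of_le {C : ℝ≥0} (hC : C ≠ 0) (h : ∀ v, N₁ v ≤ C * N₂ v) (F : E →ₗ.[ℝ] ℝ) :
    N₂.dualNorm F ≤ C * N₁.dualNorm F := by
  refine iSup_le fun g => ?_
  have hC' : (C : ℝ≥0∞) ≠ 0 := by simpa using hC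
  calc ‖F g‖ₑ / N₂ g = C * ‖F g‖ₑ / (C * N₂ g) :=
        (ENNReal.mul_div_mul_left _ _ hC' ENNReal.coe_ne_top).symm
    _ ≤ C * ‖F g‖ₑ / N₁ g := ENNReal.div_le_div_left (h g) _
    _ = C * (‖F g‖ₑ / N₁ g) := mul_div_assoc _ _ _
    _ ≤ C * N₁.dualNorm F := by
        gcongr
        exact le_iSup (fun g : F.domain => ‖F g‖ₑ / N₁ g) g

theorem inv_mul_le_of_le_mul {C : ℝ≥0} (hC : 0 < C) {x y : ℝ≥0∞} (h : x ≤ C * y) :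
    (C⁻¹ : ℝ≥0) * x ≤ y := by
  have hC' : (C : ℝ≥0∞) ≠ 0 := by simpa using hC.ne'
  rw [ENNReal.coe_inv hC.ne']
  exact (ENNReal.inv_mul_le_iff hC' ENNReal.coe_ne_top).2 h

theorem coincide_of_le {C₁ C₂ : ℝ≥0} (hC₁ : 0 < C₁) (hC₂ : 0 < C₂) (h₁ : ∀ v, N₁ v ≤ C₁ * N₂ v)
    (h₂ : ∀ v, N₂ v ≤ C₂ * N₁ v) : N₁.SpacesCoincide N₂ ∧ N₁.DualsCoincide N₂ := by
  have hs : N₁.space = N₂.space := le_antisymm (space_le_of_le h₂) (space_le_of_le h₁)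
  have d₁ := dualNorm_le_of_le hC₁.ne' h₁
  have d₂ := dualNorm_le_of_le hC₂.ne' h₂
  refine ⟨⟨hs, C₁⁻¹, C₂, inv_pos.2 hC₁, hC₂, fun v _ => ⟨inv_mul_le_of_le_mul hC₁ (h₁ v), h₂ v⟩⟩,
    ?_, C₂⁻¹, C₁, inv_pos.2 hC₂, hC₁, fun F _ => ⟨inv_mul_le_of_le_mul hC₂ (d₂ F), d₁ F⟩⟩
  ext F
  simp only [dual, mem_ofPred_eq, hs]
  exact and_congr_right fun _ =>
    ⟨fun h => (d₁ F).trans_lt (ENNReal.mul_lt_top ENNReal.coe_lt_top h),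
      fun h => (d₂ F).trans_lt (ENNReal.mul_lt_top ENNReal.coe_lt_top h)⟩

theorem le_of_sq_le {C : ℝ} {x y : ℝ≥0∞} (h : x ^ 2 ≤ ENNReal.ofReal C * y ^ 2) :
    x ≤ (√C).toNNReal * y := by
  rcases le_or_gt C 0 with hC | hC
  · rw [ENNReal.ofReal_of_nonpos hC, zero_mul] at h
    simp [pow_eq_zero_iff (two_ne_zero) |>.1 (le_antisymm h zero_le)]
  have e : ENNReal.ofReal C = (ENNReal.ofReal √C) ^ 2 := by
    rw [← ENNReal.ofReal_pow (Real.sqrt_nonneg _), Real.sq_sqrt hC.le]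
  rw [e, ← mul_pow] at h
  exact (ENNReal.pow_le_pow_left_iff two_ne_zero).1 h

theorem coincide_of_sq_le {C₁ C₂ : ℝ} (hC₁ : 0 < C₁) (hC₂ : 0 < C₂)
    (h₁ : ∀ v, N₁ v ^ 2 ≤ ENNReal.ofReal C₁ * N₂ v ^ 2)
    (h₂ : ∀ v, N₂ v ^ 2 ≤ ENNReal.ofReal C₂ * N₁ v ^ 2) :
    N₁.SpacesCoincide N₂ ∧ N₁.DualsCoincide N₂ :=
  coincide_of_le (Real.toNNReal_pos.2 (Real.sqrt_pos.2 hC₁))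
    (Real.toNNReal_pos.2 (Real.sqrt_pos.2 hC₂)) (fun v => le_of_sq_le (h₁ v))
    fun v => le_of_sq_le (h₂ v)

end ExtSeminorm

/-! ### Comparison with the Jacobi coefficient norms -/

theorem jacobiNorm_sq {a b : ℝ} (ha : -1 < a) (hb : -1 < b) (s : ℝ) (v : WeightedL2 a b) :
    jacobiNorm ha hb s v ^ 2 =
      diagSq (fun j => (1 + (j : ℝ) ^ 2) ^ s) (fun j => jacobiCoeff a b j v) :=
  rpow_half_sq _

theorem diagSq_le_mul {w w' : ℕ → ℝ} {K : ℝ} (hK : 0 ≤ K) (h : ∀ j, w j ≤ K * w' j) (c : ℕ → ℝ) :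
    diagSq w c ≤ ENNReal.ofReal K * diagSq w' c := by
  rw [← diagSq_const_mul hK]
  exact diagSq_mono h c

theorem sobolevNorm_coincide_jacobiNorm {a b : ℝ} (ha : -1 < a) (hb : -1 < b) (n : ℕ) :
    (sobolevNorm a b n).SpacesCoincide (jacobiNorm ha hb n) ∧
      (sobolevNorm a b n).DualsCoincide (jacobiNorm ha hb n) := by
  obtain ⟨c, C, hc, hC, h⟩ := exists_sobolevEigen_equiv ha hb n
  have hS : ∀ v, sobolevNorm a b n v ^ 2 =
      diagSq (sobolevEigen a b n) (fun j => jacobiCoeff a b j v) := fun v => by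
    rw [sobolevNorm_eq ha hb, rpow_half_sq, diagSq]
  refine ExtSeminorm.coincide_of_sq_le hC (inv_pos.2 hc) (fun v => ?_) fun v => ?_
  · rw [hS, jacobiNorm_sq]
    exact diagSq_le_mul hC.le (fun j => by rw [Real.rpow_natCast]; exact (h j).2) _
  · rw [hS, jacobiNorm_sq]
    refine diagSq_le_mul (inv_pos.2 hc).le (fun j => ?_) _
    rw [Real.rpow_natCast, le_inv_mul_iff₀ hc]
    exact (h j).1

theorem jacobiCoeff_sub {a b : ℝ} (ha : -1 < a) (hb : -1 < b) (u v : WeightedL2 a b) (j : ℕ) :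
    jacobiCoeff a b j (u - v : WeightedL2 a b) = jacobiCoeff a b j u - jacobiCoeff a b j v := by
  rw [eq_sub_iff_add_eq, ← jacobiCoeff_add ha hb, sub_add_cancel]

theorem exists_jacobiCoeff_indicator {a b : ℝ} (ha : -1 < a) (hb : -1 < b) (u : WeightedL2 a b)
    (S : Set ℕ) : ∃ v : WeightedL2 a b, ∀ j, jacobiCoeff a b j v =
      S.indicator (fun j => jacobiCoeff a b j u) j := by
  refine exists_of_summable_sq ha hb ?_
  have h := (hasSum_jacobiCoeff_mul ha hb u u).summable
  refine (h.indicator S).congr fun j => ?_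
  by_cases hj : j ∈ S <;> simp [hj, sq]

theorem interpolation_coincide_jacobiNorm {a b : ℝ} (ha : -1 < a) (hb : -1 < b) (m n : ℕ)
    {s θ : ℝ} (hθ0 : 0 < θ) (hθ1 : θ < 1) (hs : s = (1 - θ) * m + θ * n) :
    ((sobolevNorm a b m).interpolation (sobolevNorm a b n) θ).SpacesCoincide (jacobiNorm ha hb s) ∧
      ((sobolevNorm a b m).interpolation (sobolevNorm a b n) θ).DualsCoincide
        (jacobiNorm ha hb s) := by
  obtain ⟨c₀, C₀, hc₀, hC₀, h₀⟩ := exists_sobolevEigen_equiv ha hb m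
  obtain ⟨c₁, C₁, hc₁, hC₁, h₁⟩ := exists_sobolevEigen_equiv ha hb n
  have p₀ : ∀ j, 0 < sobolevEigen a b m j := fun j => lt_of_lt_of_le (by positivity) (h₀ j).1
  have p₁ : ∀ j, 0 < sobolevEigen a b n j := fun j => lt_of_lt_of_le (by positivity) (h₁ j).1
  have hκ := interpConst_pos hθ0 hθ1
  have hθ1' : 0 ≤ 1 - θ := by linarith
  have key := interpolation_diag_equiv (N₀ := sobolevNorm a b m) (N₁ := sobolevNorm a b n)
    (coef := fun v j => jacobiCoeff a b j v) (jacobiCoeff_sub ha hb)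
    (exists_jacobiCoeff_indicator ha hb) p₀ p₁ (sobolevNorm_eq ha hb m) (sobolevNorm_eq ha hb n)
    hθ0 hθ1
  have hmul : ∀ (A B : ℝ) (j : ℕ), 0 < A → 0 < B →
      (A * (1 + (j : ℝ) ^ 2) ^ m) ^ (1 - θ) * (B * (1 + (j : ℝ) ^ 2) ^ n) ^ θ =
        (A ^ (1 - θ) * B ^ θ) * (1 + (j : ℝ) ^ 2) ^ s := by
    intro A B j hA hB
    have hj : 0 < 1 + (j : ℝ) ^ 2 := by positivity
    rw [Real.mul_rpow hA.le (by positivity), Real.mul_rpow hB.le (by positivity), hs,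
      Real.rpow_add hj, ← Real.rpow_natCast _ m, ← Real.rpow_natCast _ n, ← Real.rpow_mul hj.le,
      ← Real.rpow_mul hj.le, mul_comm (m : ℝ), mul_comm (n : ℝ)]
    ring
  have hc : 0 < c₀ ^ (1 - θ) * c₁ ^ θ := by positivity
  have hC : 0 < C₀ ^ (1 - θ) * C₁ ^ θ := by positivity
  refine ExtSeminorm.coincide_of_sq_le (C₁ := 4 * interpConst θ * (C₀ ^ (1 - θ) * C₁ ^ θ))
    (C₂ := (c₀ ^ (1 - θ) * c₁ ^ θ)⁻¹ * (1 / 2 * interpConst θ)⁻¹)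
    (by positivity) (by positivity) (fun v => ?_) fun v => ?_
  · refine (key v).2.trans ?_
    rw [jacobiNorm_sq, ENNReal.ofReal_mul (p := 4 * interpConst θ) (by positivity), mul_assoc]
    gcongr
    refine diagSq_le_mul hC.le (fun j => ?_) _
    rw [← hmul C₀ C₁ j hC₀ hC₁]
    have := p₀ j
    have := p₁ j
    gcongr
    · exact (h₀ j).2
    · exact (h₁ j).2
  · rw [jacobiNorm_sq, ENNReal.ofReal_mul (by positivity), mul_assoc]
    refine (diagSq_le_mul (inv_pos.2 hc).le (w' := fun j => sobolevEigen a b m j ^ (1 - θ) *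
      sobolevEigen a b n j ^ θ) (fun j => ?_) _).trans ?_
    · rw [le_inv_mul_iff₀ hc, ← hmul c₀ c₁ j hc₀ hc₁]
      have := p₀ j
      gcongr
      · exact (h₀ j).1
      · exact (h₁ j).1
    · gcongr
      have hκ' : 0 < 1 / 2 * interpConst θ := by positivity
      rw [ENNReal.ofReal_inv_of_pos hκ', ← ENNReal.mul_le_iff_le_inv
        (ENNReal.ofReal_pos.2 hκ').ne' ENNReal.ofReal_ne_top]
      exact (key v).1

end WeightedSobolev

end

open WeightedSobolev in
theorem mainTheorem4 (a b : ℝ) (ha : -1 < a) (hb : -1 < b) :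
    (∀ n : ℕ, (sobolevNorm a b n).SpacesCoincide (jacobiNorm ha hb n)) ∧
    (∀ n : ℕ, 0 < n → (sobolevNorm a b n).DualsCoincide (jacobiNorm ha hb n)) ∧
    (∀ (m n : ℕ) (s θ : ℝ), m < s → s < n → s = (1 - θ) * m + θ * n →
      ((sobolevNorm a b m).interpolation (sobolevNorm a b n) θ).SpacesCoincide
        (jacobiNorm ha hb s) ∧
      ((sobolevNorm a b m).interpolation (sobolevNorm a b n) θ).DualsCoincide
        (jacobiNorm ha hb s)) := by
  refine ⟨fun n => (sobolevNorm_coincide_jacobiNorm ha hb n).1,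
    fun n _ => (sobolevNorm_coincide_jacobiNorm ha hb n).2, fun m n s θ hms hsn hs => ?_⟩
  have hmn : (0 : ℝ) < n - m := by linarith
  exact interpolation_coincide_jacobiNorm ha hb m n
    (by by_contra h; nlinarith) (by by_contra h; nlinarith) hs
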